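/- **Soundness of $\rho(\cdot)$.** Let CC be the calculus of constructions presented as a pure type system: expressions are $A,B,a,b ::= s \mid x \mid (x:A)\to B \mid \lambda x{:}A.\,b \mid a\,b$ (up to renaming of bound variables) with sorts $\ast,\Box$, the only axiom $(\ast,\Box)$, and rules $(\ast,\ast,\ast),(\Box,\ast,\ast),(\Box,\Box,\Box),(\ast,\Box,\Box)$; $\leadsto$ is one-step $\beta$-reduction in any position, the conversion rule uses $\beta$-conversion $=_\beta$, and $\Gamma\vdash a:A$ and $\vdash\Gamma$ are the usual typing and context-formation judgements. $A$ is a *kind* if it has type $\Box$ in some context; $a$ is a *$\Gamma$-constructor* if $\Gamma\vdash a:B$ and $\Gamma\vdash B:\Box$ for some $B$. Let $\mathsf{SN}$ be the set of expressions that start no infinite reduction sequence. A *base expression* is one of the form $x\,a_1\cdots a_n$ ($n\ge 0$). The expression $(\lambda x{:}A.\,b)\,a$ is its own key redex, and if $a$ has a key redex then $a\,b$ has the same key redex. A set $S$ of expressions is *saturated* if $S\subseteq\mathsf{SN}$, $S$ contains every base expression in $\mathsf{SN}$, and $a\in S$ whenever $a\in\mathsf{SN}$ has a key redex and contracting it gives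 an element of $S$. Let $\mathsf{SAT}$ be the collection of saturated sets, and for sets $S_1,S_2$ of expressions let $S_1\Rightarrow S_2=\{a \mid \forall b\in S_1,\ a\,b\in S_2\}$. For sorts and kinds define $V(\Box)=V(\ast)=\mathsf{SAT}$, and let $V((x:A)\to B)$ be the set of all functions $V(A)\to V(B)$ if $A$ is a kind, and $V(B)$ otherwise. For $\sigma$ a map on variables and $A$ a sort, kind or $\Gamma$-constructor, define - $[\![\Box]\!]_\sigma=[\![\ast]\!]_\sigma=\mathsf{SN}$ and $[\![x]\!]_\sigma=\sigma(x)$; - $[\![(x:A)\to B]\!]_\sigma=[\![A]\!]_\sigma\Rightarrow\bigcap_{S\in V(A)}[\![B]\!]_{\sigma[x\mapsto S]}$ if $A$ is a kind, and $[\![A]\!]_\sigma\Rightarrow[\![B]\!]_\sigma$ otherwise; - $[\![\lambda x{:}A.\,b]\!]_\sigma$ is the function $S\in V(A)\mapsto[\![b]\!]_{\sigma[x\mapsto S]}$ if $A$ is a kind, and $[\![b]\!]_\sigma$ otherwise; - $[\![a\,b]\!]_\sigma=[\![a]\!]_\sigma([\![b]\!]_\sigma)$ if $b$ is a $\Gamma$-constructor,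 and $[\![a]\!]_\sigma$ otherwise (below a binder $x:A$ the context is $\Gamma,x:A$). Write $\sigma\models\Gamma$ ($\sigma$ is a constructor environment for $\Gamma$) if $\vdash\Gamma$ and $\sigma(x)\in V(A)$ whenever $(x:A)\in\Gamma$ and $A$ is a kind. For a map $\rho$ from variables to expressions write $\sigma\models\rho:\Gamma$ if $\sigma\models\Gamma$ and $\rho(x)\in[\![A]\!]_\sigma$ whenever $(x:A)\in\Gamma$. Let $\rho(a)$ be the result of simultaneously substituting $\rho(x)$ for each variable $x$ of $a$. **Theorem.** If $\Gamma\vdash a:A$ and $\sigma\models\rho:\Gamma$, then $\rho(a)\in[\![A]\!]_\sigma$. -/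

import Mathlib

/-!
The calculus of constructions, presented as a pure type system with de Bruijn indices, and its
interpretation of types by saturated sets of expressions.
-/

namespace CC

/-- The two sorts `∗` and `□`. -/
inductive Srt : Type
  | star : Srt
  | box : Srt

/-- The only axiom is `(∗, □)`. -/
inductive Ax : Srt → Srt → Prop
  | star_box : Ax Srt.star Srt.box

/-- The rules of the calculus of constructions. -/
inductive Rule : Srt → Srt → Srt → Prop
  | star_star : Rule Srt.star Srt.star Srt.star
  | box_star : Rule Srt.box Srt.star Srt.star
  | box_box : Rule Srt.box Srt.box Srt.box
  | star_box : Rule Srt.star Srt.box Srt.box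

/-- Expressions, up to renaming of bound variables. Variables are de Bruijn indices; the second
argument of `pi` and of `lam` is the scope of one bound variable. -/
inductive Exp : Type
  | sort : Srt → Exp
  | var : ℕ → Exp
  | pi : Exp → Exp → Exp
  | lam : Exp → Exp → Exp
  | app : Exp → Exp → Exp

/-- Extend an assignment on variables by a value for a new variable `0`. -/
def cons {α : Type*} (a : α) (f : ℕ → α) : ℕ → α
  | 0 => a
  | n + 1 => f n

/-- Apply a renaming of the free variables. -/
def Exp.rename : (ℕ → ℕ) → Exp → Exp
  | _, .sort s => .sort s
  | f, .var n => .var (f n)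
  | f, .pi A B => .pi (A.rename f) (B.rename (cons 0 fun n => f n + 1))
  | f, .lam A b => .lam (A.rename f) (b.rename (cons 0 fun n => f n + 1))
  | f, .app a b => .app (a.rename f) (b.rename f)

/-- Weakening by one variable. -/
def Exp.shift (a : Exp) : Exp := a.rename Nat.succ

/-- The substitution used below a binder: it fixes the bound variable. -/
def up (ρ : ℕ → Exp) : ℕ → Exp := cons (.var 0) fun n => (ρ n).shift

/-- Capture-avoiding simultaneous substitution of `ρ n` for every variable `n`. -/
def Exp.subst : (ℕ → Exp) → Exp → Exp
  | _, .sort s => .sort s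
  | ρ, .var n => ρ n
  | ρ, .pi A B => .pi (A.subst ρ) (B.subst (up ρ))
  | ρ, .lam A b => .lam (A.subst ρ) (b.subst (up ρ))
  | ρ, .app a b => .app (a.subst ρ) (b.subst ρ)

/-- `b.inst a` is `[a/x]b`, where `x` is the variable `0` of `b`. -/
def Exp.inst (b a : Exp) : Exp := b.subst (cons a Exp.var)

/-- One step of beta reduction, in any position. -/
inductive Step : Exp → Exp → Prop
  | beta (A b a : Exp) : Step (.app (.lam A b) a) (b.inst a)
  | pi_left {A A' : Exp} (B : Exp) : Step A A' → Step (.pi A B) (.pi A' B)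
  | pi_right (A : Exp) {B B' : Exp} : Step B B' → Step (.pi A B) (.pi A B')
  | lam_left {A A' : Exp} (b : Exp) : Step A A' → Step (.lam A b) (.lam A' b)
  | lam_right (A : Exp) {b b' : Exp} : Step b b' → Step (.lam A b) (.lam A b')
  | app_left {a a' : Exp} (b : Exp) : Step a a' → Step (.app a b) (.app a' b)
  | app_right (a : Exp) {b b' : Exp} : Step b b' → Step (.app a b) (.app a b')

/-- Beta conversion: the reflexive, symmetric, transitive closure of `Step`. -/
def Conv : Exp → Exp → Prop := Relation.EqvGen Step

/-- Contexts; the head of the list is the most recent declaration, i.e. that of variable `0`. -/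
abbrev Ctx : Type := List Exp

/-- `Lookup Γ n A` : the declaration `n : A` is in `Γ`, with `A` read in the whole of `Γ`. -/
inductive Lookup : Ctx → ℕ → Exp → Prop
  | zero (Γ : Ctx) (A : Exp) : Lookup (A :: Γ) 0 A.shift
  | succ {Γ : Ctx} {n : ℕ} {A : Exp} (B : Exp) : Lookup Γ n A → Lookup (B :: Γ) (n + 1) A.shift

mutual

/-- `Typing Γ a A` is the judgement `Γ ⊢ a : A`. -/
inductive Typing : Ctx → Exp → Exp → Prop
  | sort {Γ : Ctx} {s₁ s₂ : Srt} : Wf Γ → Ax s₁ s₂ → Typing Γ (.sort s₁) (.sort s₂)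
  | var {Γ : Ctx} {n : ℕ} {A : Exp} : Wf Γ → Lookup Γ n A → Typing Γ (.var n) A
  | pi {Γ : Ctx} {A B : Exp} {s₁ s₂ s₃ : Srt} :
      Typing Γ A (.sort s₁) → Typing (A :: Γ) B (.sort s₂) → Rule s₁ s₂ s₃ →
        Typing Γ (.pi A B) (.sort s₃)
  | lam {Γ : Ctx} {A B b : Exp} {s : Srt} :
      Typing Γ (.pi A B) (.sort s) → Typing (A :: Γ) b B → Typing Γ (.lam A b) (.pi A B)
  | app {Γ : Ctx} {A B a b : Exp} :
      Typing Γ a (.pi A B) → Typing Γ b A → Typing Γ (.app a b) (B.inst b)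
  | conv {Γ : Ctx} {a A B : Exp} {s : Srt} :
      Typing Γ a A → Typing Γ B (.sort s) → Conv A B → Typing Γ a B

/-- `Wf Γ` is the judgement `⊢ Γ`. -/
inductive Wf : Ctx → Prop
  | nil : Wf []
  | cons {Γ : Ctx} {A : Exp} {s : Srt} : Typing Γ A (.sort s) → Wf (A :: Γ)

end

/-- `A` is a kind: it has type `□` (in some context). -/
def IsKind (A : Exp) : Prop := ∃ Γ : Ctx, Typing Γ A (.sort .box)

/-- `a` is a `Γ`-constructor: it has a type in `Γ` that itself has type `□` in `Γ`. -/
def IsConstructor (Γ : Ctx) (a : Exp) : Prop :=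
  ∃ B : Exp, Typing Γ a B ∧ Typing Γ B (.sort .box)

/-- The strongly normalizing expressions: those that start no infinite reduction sequence. -/
def SN : Set Exp := {a | ¬ ∃ f : ℕ → Exp, f 0 = a ∧ ∀ n, Step (f n) (f (n + 1))}

/-- Base expressions `x a₁ … aₙ`. -/
inductive IsBase : Exp → Prop
  | var (n : ℕ) : IsBase (.var n)
  | app {a : Exp} (b : Exp) : IsBase a → IsBase (.app a b)

/-- `KeyRed a a'` : `a` has a key redex, and `a'` is obtained from `a` by contracting it. -/
inductive KeyRed : Exp → Exp → Prop
  | beta (A b a : Exp) : KeyRed (.app (.lam A b) a) (b.inst a)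
  | app {a a' : Exp} (b : Exp) : KeyRed a a' → KeyRed (.app a b) (.app a' b)

/-- Saturated sets of expressions. -/
structure Saturated (S : Set Exp) : Prop where
  subset_SN : S ⊆ SN
  base_mem : ∀ a, a ∈ SN → IsBase a → a ∈ S
  expand : ∀ a a', a ∈ SN → KeyRed a a' → a' ∈ S → a ∈ S

/-- The set of expressions that map `S₁` into `S₂` when applied. -/
def arrow (S₁ S₂ : Set Exp) : Set Exp := {a | ∀ b ∈ S₁, Exp.app a b ∈ S₂}

/-! Interpretations are sets in the sense of set theory: sets of expressions, functions between
collections of such sets, and so on. To have all of them in one universe, expressions are coded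
as elements of `ZFSet`. -/

/-- The Zermelo numerals. -/
noncomputable def num : ℕ → ZFSet.{0}
  | 0 => ∅
  | n + 1 => {num n}

/-- An injective coding of sorts. -/
noncomputable def Srt.code : Srt → ZFSet.{0}
  | .star => num 0
  | .box => num 1

/-- An injective coding of expressions. -/
noncomputable def Exp.code : Exp → ZFSet.{0}
  | .sort s => ZFSet.pair (num 0) s.code
  | .var n => ZFSet.pair (num 1) (num n)
  | .pi A B => ZFSet.pair (num 2) (ZFSet.pair A.code B.code)
  | .lam A b => ZFSet.pair (num 3) (ZFSet.pair A.code b.code)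
  | .app a b => ZFSet.pair (num 4) (ZFSet.pair a.code b.code)

theorem num_injective : Function.Injective num := by
  intro m
  induction m with
  | zero =>
    intro n h
    cases n with
    | zero => rfl
    | succ n =>
      exfalso
      have h1 : num n ∈ num (n + 1) := by simp [num]
      rw [← h] at h1
      simp [num] at h1
  | succ m ih =>
    intro n h
    cases n with
    | zero =>
      exfalso
      have h1 : num m ∈ num (m + 1) := by simp [num]
      rw [h] at h1
      simp [num] at h1
    | succ n =>
      have h1 : num m ∈ num (m + 1) := by simp [num]
      rw [h] at h1
      simp only [num, ZFSet.mem_singleton] at h1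
      rw [ih h1]

theorem Srt.code_injective : Function.Injective Srt.code := by
  intro s t h
  cases s <;> cases t <;> simp only [Srt.code] at h <;> first | rfl | skip
  all_goals exact absurd (num_injective h) (by decide)

theorem Exp.code_injective : Function.Injective Exp.code := by
  intro a
  induction a with
  | sort s =>
    intro b h
    cases b <;> simp only [Exp.code, ZFSet.pair_inj, num_injective.eq_iff] at h <;>
      simp_all [Srt.code_injective.eq_iff]
  | var n =>
    intro b h
    cases b <;> simp only [Exp.code, ZFSet.pair_inj, num_injective.eq_iff] at h <;> simp_all
  | pi A B ihA ihB =>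
    intro b h
    cases b <;> simp only [Exp.code, ZFSet.pair_inj, num_injective.eq_iff] at h
    case pi A' B' => rw [ihA h.2.1, ihB h.2.2]
    all_goals simp at h
  | lam A B ihA ihB =>
    intro b h
    cases b <;> simp only [Exp.code, ZFSet.pair_inj, num_injective.eq_iff] at h
    case lam A' B' => rw [ihA h.2.1, ihB h.2.2]
    all_goals simp at h
  | app A B ihA ihB =>
    intro b h
    cases b <;> simp only [Exp.code, ZFSet.pair_inj, num_injective.eq_iff] at h
    case app A' B' => rw [ihA h.2.1, ihB h.2.2]
    all_goals simp at h

/-- A set of expressions as a `ZFSet`. -/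
noncomputable def ofSet (S : Set Exp) : ZFSet.{0} := ZFSet.range fun a : S => a.1.code

/-- The expressions that (through their codes) belong to a `ZFSet`. -/
def elems (z : ZFSet.{0}) : Set Exp := {a | a.code ∈ z}

theorem elems_ofSet (S : Set Exp) : elems (ofSet S) = S := by
  ext a
  simp [elems, ofSet, Exp.code_injective.eq_iff]

/-- The collection of all saturated sets. -/
noncomputable def SAT : ZFSet.{0} := ZFSet.range fun S : {S : Set Exp // Saturated S} => ofSet S.1

/-- The set-theoretic function with domain `D` that maps each `S ∈ D` to `F S`. -/
noncomputable def graph (D : ZFSet.{0}) (F : ZFSet.{0} → ZFSet.{0}) : ZFSet.{0} :=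
  @ZFSet.map F (Classical.allZFSetDefinable _) D

theorem mem_graph {D : ZFSet.{0}} {F : ZFSet.{0} → ZFSet.{0}} {p : ZFSet.{0}} :
    p ∈ graph D F ↔ ∃ S ∈ D, ZFSet.pair S (F S) = p :=
  @ZFSet.mem_map F (Classical.allZFSetDefinable _) D p

open scoped Classical in
/-- The value of the set-theoretic function `f` at `x` (`∅` if `x` is not in its domain). -/
noncomputable def applyFun (f x : ZFSet.{0}) : ZFSet.{0} :=
  if h : ∃ y, ZFSet.pair x y ∈ f then h.choose else ∅

theorem applyFun_graph {D : ZFSet.{0}} {F : ZFSet.{0} → ZFSet.{0}} {S : ZFSet.{0}} (hS : S ∈ D) :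
    applyFun (graph D F) S = F S := by
  have h : ∃ y, ZFSet.pair S y ∈ graph D F := ⟨F S, mem_graph.2 ⟨S, hS, rfl⟩⟩
  have h2 := h.choose_spec
  rw [mem_graph] at h2
  obtain ⟨T, -, hT⟩ := h2
  rw [ZFSet.pair_inj] at hT
  rw [applyFun, dif_pos h, ← hT.2, hT.1]

open scoped Classical in
/-- The range `V(A)` of the interpretation of expressions of type `A`, where `A` is a sort or a
kind. For a kind `A`, `V((x : A) → B)` is the collection of all set-theoretic functions from
`V(A)` to `V(B)`. (On other expressions the value is irrelevant.) -/
noncomputable def V : Exp → ZFSet.{0}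
  | .sort _ => SAT
  | .pi A B => if IsKind A then ZFSet.funs (V A) (V B) else V B
  | .var _ => ∅
  | .lam _ _ => ∅
  | .app _ _ => ∅

open scoped Classical in
/-- `interp A Γ σ` is the interpretation `⟦A⟧_σ`, where `A` is a sort, a kind or a
`Γ`-constructor. Below a binder whose variable is not a constructor variable, `σ` is left alone;
the value `∅` at the new index `0` is a filler. -/
noncomputable def interp : Exp → Ctx → (ℕ → ZFSet.{0}) → ZFSet.{0}
  | .sort _, _, _ => ofSet SN
  | .var n, _, σ => σ n
  | .pi A B, Γ, σ =>
      if IsKind A then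
        ofSet (arrow (elems (interp A Γ σ))
          {a | ∀ S ∈ V A, a ∈ elems (interp B (A :: Γ) (cons S σ))})
      else
        ofSet (arrow (elems (interp A Γ σ)) (elems (interp B (A :: Γ) (cons ∅ σ))))
  | .lam A b, Γ, σ =>
      if IsKind A then
        graph (V A) fun S => interp b (A :: Γ) (cons S σ)
      else
        interp b (A :: Γ) (cons ∅ σ)
  | .app a b, Γ, σ =>
      if IsConstructor Γ b then
        applyFun (interp a Γ σ) (interp b Γ σ)
      else
        interp a Γ σ

/-- `σ ⊨ Γ` : `σ` is a constructor environment for the well-formed context `Γ`. -/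
structure ConstructorEnv (σ : ℕ → ZFSet.{0}) (Γ : Ctx) : Prop where
  wf : Wf Γ
  mem : ∀ n A, Lookup Γ n A → IsKind A → σ n ∈ V A

/-- `σ ⊨ ρ : Γ` : `ρ` is a term environment for `Γ` with respect to `σ`. -/
structure TermEnv (σ : ℕ → ZFSet.{0}) (ρ : ℕ → Exp) (Γ : Ctx) : Prop where
  env : ConstructorEnv σ Γ
  mem : ∀ n A, Lookup Γ n A → ρ n ∈ elems (interp A Γ σ)

end CC

namespace CC

-- The theorem is an induction on the derivation of Γ ⊢ a : A (`Typing.sound`). The application rule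
-- unfolds ⇒, with the interpretation of the argument as the set S when the domain is a kind. The
-- abstraction rule uses closure of saturated sets under expansion of key redexes. The product rule
-- asks only for strong normalization.
--
-- Three facts about interpretations carry these cases. By `interp_mem` an interpretation lies in
-- the range V of its type, so types denote saturated sets and a constructor argument is an
-- admissible S. By `interp_subst`, used through `interp_inst`, substituting in an expression
-- amounts to changing the environment. By `interp_conv`, convertible types have equal
-- interpretations, which settles the conversion rule.
--
-- The obstacle is that V and the interpretation branch on being a kind or a constructor, notions
-- defined by typability. Confluence, subject reduction and uniqueness of types turn both tests into
-- the question whether a certain sort is □ (`Typing.isKind_iff`, `Typing.isConstructor_iff`). That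
-- sort survives substitution and conversion, and an argument is a constructor exactly when the
-- domain is a kind, so abstraction and application always take matching branches.

@[simp] theorem cons_zero {α : Type*} (a : α) (f : ℕ → α) : cons a f 0 = a := rfl

@[simp] theorem cons_succ {α : Type*} (a : α) (f : ℕ → α) (n : ℕ) : cons a f (n + 1) = f n := rfl

/-! ### The calculus of substitutions -/

theorem up_var : up Exp.var = Exp.var := by
  funext n; cases n <;> rfl

theorem up_renaming (f : ℕ → ℕ) :
    up (fun n => .var (f n)) = fun n => .var (cons 0 (fun n => f n + 1) n) := by
  funext n; cases n <;> rfl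

theorem Exp.rename_eq_subst (a : Exp) (f : ℕ → ℕ) :
    a.rename f = a.subst fun n => .var (f n) := by
  induction a generalizing f <;> simp_all [Exp.rename, Exp.subst, up_renaming]

theorem Exp.subst_var (a : Exp) : a.subst Exp.var = a := by
  induction a <;> simp_all [Exp.subst, up_var]

theorem Exp.subst_rename (a : Exp) (f : ℕ → ℕ) (θ : ℕ → Exp) :
    (a.rename f).subst θ = a.subst fun n => θ (f n) := by
  have h (f : ℕ → ℕ) (θ : ℕ → Exp) :
      (fun n => up θ (cons 0 (fun n => f n + 1) n)) = up fun n => θ (f n) := by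
    funext n; cases n <;> rfl
  induction a generalizing f θ <;> simp_all [Exp.rename, Exp.subst]

theorem Exp.rename_rename (a : Exp) (f g : ℕ → ℕ) :
    (a.rename f).rename g = a.rename fun n => g (f n) := by
  rw [rename_eq_subst _ g, subst_rename, ← rename_eq_subst]

theorem Exp.rename_subst (a : Exp) (f : ℕ → ℕ) (θ : ℕ → Exp) :
    (a.subst θ).rename f = a.subst fun n => (θ n).rename f := by
  have h (f : ℕ → ℕ) (θ : ℕ → Exp) :
      (fun n => (up θ n).rename (cons 0 fun n => f n + 1)) = up fun n => (θ n).rename f := by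
    funext n
    cases n with
    | zero => rfl
    | succ n => simp [up, Exp.shift, rename_rename]
  induction a generalizing f θ <;> simp_all [Exp.rename, Exp.subst]

theorem Exp.shift_subst_up (a : Exp) (θ : ℕ → Exp) :
    a.shift.subst (up θ) = (a.subst θ).shift := by
  rw [shift, subst_rename, shift, rename_subst]; rfl

theorem Exp.subst_subst (a : Exp) (θ τ : ℕ → Exp) :
    (a.subst θ).subst τ = a.subst fun n => (θ n).subst τ := by
  have h (θ τ : ℕ → Exp) :
      (fun n => (up θ n).subst (up τ)) = up fun n => (θ n).subst τ := by
    funext n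
    cases n with
    | zero => rfl
    | succ n => exact shift_subst_up _ _
  induction a generalizing θ τ <;> simp_all [Exp.subst]

theorem Exp.shift_subst_cons (a b : Exp) (θ : ℕ → Exp) :
    a.shift.subst (cons b θ) = a.subst θ := by
  rw [shift, subst_rename]; rfl

theorem Exp.shift_inst (a b : Exp) : a.shift.inst b = a := by
  rw [inst, shift_subst_cons, subst_var]

theorem Exp.subst_up_inst (b a : Exp) (θ : ℕ → Exp) :
    (b.subst (up θ)).inst a = b.subst (cons a θ) := by
  rw [inst, subst_subst]
  congr 1
  funext n
  cases n with
  | zero => rfl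
  | succ n => exact shift_inst _ _

theorem Exp.inst_subst (b a : Exp) (θ : ℕ → Exp) :
    (b.inst a).subst θ = (b.subst (up θ)).inst (a.subst θ) := by
  rw [subst_up_inst, inst, subst_subst]
  congr 1
  funext n
  cases n <;> rfl

theorem Exp.inst_rename (b a : Exp) (f : ℕ → ℕ) :
    (b.inst a).rename f = (b.rename (cons 0 fun n => f n + 1)).inst (a.rename f) := by
  simp only [rename_eq_subst, inst_subst, up_renaming]

theorem Exp.shift_rename (a : Exp) (f : ℕ → ℕ) :
    a.shift.rename (cons 0 fun n => f n + 1) = (a.rename f).shift := by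
  simp only [shift, rename_rename]; rfl

/-! ### Reduction -/

/-- Beta reduction in any number of steps. -/
abbrev Red : Exp → Exp → Prop := Relation.ReflTransGen Step

theorem Step.subst {a a' : Exp} (h : Step a a') (θ : ℕ → Exp) :
    Step (a.subst θ) (a'.subst θ) := by
  induction h generalizing θ with
  | beta A b a => rw [Exp.inst_subst]; exact .beta _ _ _
  | pi_left B _ ih => exact .pi_left _ (ih _)
  | pi_right A _ ih => exact .pi_right _ (ih _)
  | lam_left b _ ih => exact .lam_left _ (ih _)
  | lam_right A _ ih => exact .lam_right _ (ih _)
  | app_left b _ ih => exact .app_left _ (ih _)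
  | app_right a _ ih => exact .app_right _ (ih _)

theorem Red.subst {a a' : Exp} (h : Red a a') (θ : ℕ → Exp) : Red (a.subst θ) (a'.subst θ) :=
  h.lift _ fun _ _ h => h.subst θ

theorem Red.shift {a a' : Exp} (h : Red a a') : Red a.shift a'.shift := by
  simp only [Exp.shift, Exp.rename_eq_subst]
  exact h.subst _

theorem Red.pi {A A' B B' : Exp} (hA : Red A A') (hB : Red B B') : Red (.pi A B) (.pi A' B') :=
  (hA.lift (Exp.pi · B) fun _ _ h => .pi_left _ h).trans
    (hB.lift (Exp.pi A') fun _ _ h => .pi_right _ h)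

theorem Red.lam {A A' b b' : Exp} (hA : Red A A') (hb : Red b b') : Red (.lam A b) (.lam A' b') :=
  (hA.lift (Exp.lam · b) fun _ _ h => .lam_left _ h).trans
    (hb.lift (Exp.lam A') fun _ _ h => .lam_right _ h)

theorem Red.app {a a' b b' : Exp} (ha : Red a a') (hb : Red b b') : Red (.app a b) (.app a' b') :=
  (ha.lift (Exp.app · b) fun _ _ h => .app_left _ h).trans
    (hb.lift (Exp.app a') fun _ _ h => .app_right _ h)

theorem red_up {θ τ : ℕ → Exp} (h : ∀ n, Red (θ n) (τ n)) (n : ℕ) : Red (up θ n) (up τ n) := by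
  cases n with
  | zero => exact .refl
  | succ n => exact (h n).shift

theorem red_subst_congr (a : Exp) {θ τ : ℕ → Exp} (h : ∀ n, Red (θ n) (τ n)) :
    Red (a.subst θ) (a.subst τ) := by
  induction a generalizing θ τ with
  | sort s => exact .refl
  | var n => exact h n
  | pi A B ihA ihB => exact .pi (ihA h) (ihB (red_up h))
  | lam A b ihA ihb => exact .lam (ihA h) (ihb (red_up h))
  | app a b iha ihb => exact .app (iha h) (ihb h)

theorem Red.inst_right (b : Exp) {a a' : Exp} (h : Red a a') : Red (b.inst a) (b.inst a') := by
  refine red_subst_congr b fun n => ?_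
  cases n with
  | zero => exact h
  | succ n => exact .refl

/-! ### Confluence -/

/-- Parallel beta reduction. -/
inductive Par : Exp → Exp → Prop
  | sort (s : Srt) : Par (.sort s) (.sort s)
  | var (n : ℕ) : Par (.var n) (.var n)
  | pi {A A' B B' : Exp} : Par A A' → Par B B' → Par (.pi A B) (.pi A' B')
  | lam {A A' b b' : Exp} : Par A A' → Par b b' → Par (.lam A b) (.lam A' b')
  | app {a a' b b' : Exp} : Par a a' → Par b b' → Par (.app a b) (.app a' b')
  | beta (A : Exp) {a a' b b' : Exp} : Par b b' → Par a a' →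
      Par (.app (.lam A b) a) (b'.inst a')

theorem Par.refl (a : Exp) : Par a a := by
  induction a with
  | sort s => exact .sort s
  | var n => exact .var n
  | pi _ _ h₁ h₂ => exact .pi h₁ h₂
  | lam _ _ h₁ h₂ => exact .lam h₁ h₂
  | app _ _ h₁ h₂ => exact .app h₁ h₂

theorem Step.par {a a' : Exp} (h : Step a a') : Par a a' := by
  induction h with
  | beta A b a => exact .beta A (.refl _) (.refl _)
  | pi_left B _ ih => exact .pi ih (.refl _)
  | pi_right A _ ih => exact .pi (.refl _) ih
  | lam_left b _ ih => exact .lam ih (.refl _)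
  | lam_right A _ ih => exact .lam (.refl _) ih
  | app_left b _ ih => exact .app ih (.refl _)
  | app_right a _ ih => exact .app (.refl _) ih

theorem Par.red {a a' : Exp} (h : Par a a') : Red a a' := by
  induction h with
  | sort s => exact .refl
  | var n => exact .refl
  | pi _ _ h₁ h₂ => exact .pi h₁ h₂
  | lam _ _ h₁ h₂ => exact .lam h₁ h₂
  | app _ _ h₁ h₂ => exact .app h₁ h₂
  | beta A _ _ h₁ h₂ => exact (Red.app (.lam .refl h₁) h₂).tail (.beta _ _ _)

theorem Par.rename {a a' : Exp} (h : Par a a') (f : ℕ → ℕ) :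
    Par (a.rename f) (a'.rename f) := by
  induction h generalizing f with
  | sort s => exact .sort s
  | var n => exact .var _
  | pi _ _ h₁ h₂ => exact .pi (h₁ _) (h₂ _)
  | lam _ _ h₁ h₂ => exact .lam (h₁ _) (h₂ _)
  | app _ _ h₁ h₂ => exact .app (h₁ _) (h₂ _)
  | beta A _ _ h₁ h₂ => rw [Exp.inst_rename]; exact .beta _ (h₁ _) (h₂ _)

theorem par_up {θ τ : ℕ → Exp} (h : ∀ n, Par (θ n) (τ n)) (n : ℕ) : Par (up θ n) (up τ n) := by
  cases n with
  | zero => exact .refl _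
  | succ n => exact (h n).rename _

theorem Par.subst {a a' : Exp} (h : Par a a') {θ τ : ℕ → Exp} (hθ : ∀ n, Par (θ n) (τ n)) :
    Par (a.subst θ) (a'.subst τ) := by
  induction h generalizing θ τ with
  | sort s => exact .sort s
  | var n => exact hθ n
  | pi _ _ h₁ h₂ => exact .pi (h₁ hθ) (h₂ (par_up hθ))
  | lam _ _ h₁ h₂ => exact .lam (h₁ hθ) (h₂ (par_up hθ))
  | app _ _ h₁ h₂ => exact .app (h₁ hθ) (h₂ hθ)
  | beta A _ _ h₁ h₂ => rw [Exp.inst_subst]; exact .beta _ (h₁ (par_up hθ)) (h₂ hθ)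

theorem Par.inst {a a' b b' : Exp} (hb : Par b b') (ha : Par a a') :
    Par (b.inst a) (b'.inst a') := by
  refine hb.subst fun n => ?_
  cases n with
  | zero => exact ha
  | succ n => exact .var n

theorem Par.diamond {a b c : Exp} (hb : Par a b) (hc : Par a c) : ∃ d, Par b d ∧ Par c d := by
  induction hb generalizing c with
  | sort s => exact ⟨c, hc, .refl _⟩
  | var n => exact ⟨c, hc, .refl _⟩
  | pi _ _ h₁ h₂ =>
    cases hc with
    | pi k₁ k₂ =>
      obtain ⟨d₁, p₁, q₁⟩ := h₁ k₁
      obtain ⟨d₂, p₂, q₂⟩ := h₂ k₂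
      exact ⟨_, .pi p₁ p₂, .pi q₁ q₂⟩
  | lam _ _ h₁ h₂ =>
    cases hc with
    | lam k₁ k₂ =>
      obtain ⟨d₁, p₁, q₁⟩ := h₁ k₁
      obtain ⟨d₂, p₂, q₂⟩ := h₂ k₂
      exact ⟨_, .lam p₁ p₂, .lam q₁ q₂⟩
  | app r _ h₁ h₂ =>
    cases hc with
    | app k₁ k₂ =>
      obtain ⟨d₁, p₁, q₁⟩ := h₁ k₁
      obtain ⟨d₂, p₂, q₂⟩ := h₂ k₂
      exact ⟨_, .app p₁ p₂, .app q₁ q₂⟩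
    | beta A k₁ k₂ =>
      -- The induction hypothesis speaks of the whole abstraction, so the reduct of its body is
      -- wrapped in an abstraction with unchanged domain. The common reduct is then an abstraction
      -- too, and its body is what gets instantiated.
      obtain ⟨d₁, p₁, q₁⟩ := h₁ (.lam (.refl A) k₁)
      obtain ⟨d₂, p₂, q₂⟩ := h₂ k₂
      cases r
      cases p₁ with
      | lam _ p₁ =>
        cases q₁ with
        | lam _ q₁ => exact ⟨_, .beta _ p₁ p₂, q₁.inst q₂⟩
  | beta A _ _ h₁ h₂ =>
    cases hc with
    | app k₁ k₂ =>
      cases k₁ with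
      | lam _ k₁ =>
        obtain ⟨d₁, p₁, q₁⟩ := h₁ k₁
        obtain ⟨d₂, p₂, q₂⟩ := h₂ k₂
        exact ⟨_, p₁.inst p₂, .beta _ q₁ q₂⟩
    | beta A k₁ k₂ =>
      obtain ⟨d₁, p₁, q₁⟩ := h₁ k₁
      obtain ⟨d₂, p₂, q₂⟩ := h₂ k₂
      exact ⟨_, p₁.inst p₂, q₁.inst q₂⟩

theorem reflTransGen_par {a b : Exp} : Relation.ReflTransGen Par a b ↔ Red a b := by
  constructor
  · intro h
    induction h with
    | refl => exact .refl
    | tail _ h ih => exact ih.trans h.red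
  · exact fun h => h.lift id fun _ _ h => Step.par h

theorem Red.confluent {a b c : Exp} (hb : Red a b) (hc : Red a c) : ∃ d, Red b d ∧ Red c d := by
  obtain ⟨d, h₁, h₂⟩ := Relation.church_rosser
    (fun a b c hb hc => by
      obtain ⟨d, h₁, h₂⟩ := Par.diamond hb hc
      exact ⟨d, .single h₁, .single h₂⟩)
    (reflTransGen_par.2 hb) (reflTransGen_par.2 hc)
  exact ⟨d, reflTransGen_par.1 h₁, reflTransGen_par.1 h₂⟩

/-! ### Conversion -/

theorem Conv.refl (a : Exp) : Conv a a := Relation.EqvGen.refl a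

theorem Conv.symm {a b : Exp} (h : Conv a b) : Conv b a := Relation.EqvGen.symm _ _ h

theorem Conv.trans {a b c : Exp} (h : Conv a b) (k : Conv b c) : Conv a c :=
  Relation.EqvGen.trans _ _ _ h k

theorem Red.conv {a b : Exp} (h : Red a b) : Conv a b := by
  induction h with
  | refl => exact .refl _
  | tail _ h ih => exact ih.trans (Relation.EqvGen.rel _ _ h)

theorem Step.conv {a b : Exp} (h : Step a b) : Conv a b := Relation.EqvGen.rel _ _ h

theorem Conv.join {a b : Exp} (h : Conv a b) : ∃ c, Red a c ∧ Red b c := by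
  induction h with
  | rel _ _ h => exact ⟨_, .single h, .refl⟩
  | refl => exact ⟨_, .refl, .refl⟩
  | symm _ _ _ ih =>
    obtain ⟨c, h₁, h₂⟩ := ih
    exact ⟨c, h₂, h₁⟩
  | trans _ _ _ _ _ ih₁ ih₂ =>
    obtain ⟨c, h₁, h₂⟩ := ih₁
    obtain ⟨d, k₁, k₂⟩ := ih₂
    obtain ⟨e, l₁, l₂⟩ := h₂.confluent k₁
    exact ⟨e, h₁.trans l₁, k₂.trans l₂⟩

theorem Conv.subst {a b : Exp} (h : Conv a b) (θ : ℕ → Exp) : Conv (a.subst θ) (b.subst θ) := by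
  obtain ⟨c, h₁, h₂⟩ := h.join
  exact (h₁.subst θ).conv.trans (h₂.subst θ).conv.symm

theorem Conv.rename {a b : Exp} (h : Conv a b) (f : ℕ → ℕ) : Conv (a.rename f) (b.rename f) := by
  simp only [Exp.rename_eq_subst]
  exact h.subst _

theorem Conv.pi {A A' B B' : Exp} (hA : Conv A A') (hB : Conv B B') :
    Conv (.pi A B) (.pi A' B') := by
  obtain ⟨C, h₁, h₂⟩ := hA.join
  obtain ⟨D, k₁, k₂⟩ := hB.join
  exact (h₁.pi k₁).conv.trans (h₂.pi k₂).conv.symm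

theorem Red.sort_eq {s : Srt} {a : Exp} (h : Red (.sort s) a) : a = .sort s := by
  induction h with
  | refl => rfl
  | tail _ h ih => subst ih; cases h

theorem Red.pi_inv {A B C : Exp} (h : Red (.pi A B) C) :
    ∃ A' B', C = .pi A' B' ∧ Red A A' ∧ Red B B' := by
  induction h with
  | refl => exact ⟨_, _, rfl, .refl, .refl⟩
  | tail _ h ih =>
    obtain ⟨A', B', rfl, hA, hB⟩ := ih
    cases h with
    | pi_left _ h => exact ⟨_, _, rfl, hA.tail h, hB⟩
    | pi_right _ h => exact ⟨_, _, rfl, hA, hB.tail h⟩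

theorem Conv.red_sort {a : Exp} {s : Srt} (h : Conv a (.sort s)) : Red a (.sort s) := by
  obtain ⟨c, h₁, h₂⟩ := h.join
  rwa [h₂.sort_eq] at h₁

theorem Conv.sort_inj {s t : Srt} (h : Conv (.sort s) (.sort t)) : s = t := by
  have := h.red_sort.sort_eq
  simp_all

theorem not_conv_pi_sort {A B : Exp} {s : Srt} : ¬ Conv (.pi A B) (.sort s) := by
  intro h
  obtain ⟨A', B', h, -⟩ := h.red_sort.pi_inv
  cases h

theorem Conv.pi_inj {A A' B B' : Exp} (h : Conv (.pi A B) (.pi A' B')) :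
    Conv A A' ∧ Conv B B' := by
  obtain ⟨C, h₁, h₂⟩ := h.join
  obtain ⟨D, E, rfl, hD, hE⟩ := h₁.pi_inv
  obtain ⟨D', E', h, hD', hE'⟩ := h₂.pi_inv
  cases h
  exact ⟨hD.conv.trans hD'.conv.symm, hE.conv.trans hE'.conv.symm⟩

/-! ### Typing -/

/-- A product has the sort of its codomain. Hence whether a product is a kind depends on its
codomain alone, and `Typing.pi_cod` can keep the sort. -/
theorem Rule.eq {s₁ s₂ s₃ : Srt} (h : Rule s₁ s₂ s₃) : s₃ = s₂ := by cases h <;> rfl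

theorem rule_intro (s₁ s₂ : Srt) : Rule s₁ s₂ s₂ := by
  cases s₁ <;> cases s₂ <;> constructor

/-- Induction on typing derivations that leaves out the derivations of `⊢ Γ`. -/
@[elab_as_elim]
theorem Typing.ind {P : ∀ (Γ : Ctx) (a A : Exp), Typing Γ a A → Prop}
    (sort : ∀ {Γ : Ctx} (h : Wf Γ), P Γ (.sort .star) (.sort .box) (.sort h .star_box))
    (var : ∀ {Γ : Ctx} {n : ℕ} {A : Exp} (h : Wf Γ) (k : Lookup Γ n A),
      P Γ (.var n) A (.var h k))
    (pi : ∀ {Γ : Ctx} {A B : Exp} {s₁ s₂ : Srt} (h : Typing Γ A (.sort s₁))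
      (k : Typing (A :: Γ) B (.sort s₂)), P Γ A (.sort s₁) h → P (A :: Γ) B (.sort s₂) k →
        P Γ (.pi A B) (.sort s₂) (.pi h k (rule_intro _ _)))
    (lam : ∀ {Γ : Ctx} {A B b : Exp} {s : Srt} (h : Typing Γ (.pi A B) (.sort s))
      (k : Typing (A :: Γ) b B), P Γ (.pi A B) (.sort s) h → P (A :: Γ) b B k →
        P Γ (.lam A b) (.pi A B) (.lam h k))
    (app : ∀ {Γ : Ctx} {A B a b : Exp} (h : Typing Γ a (.pi A B)) (k : Typing Γ b A),
      P Γ a (.pi A B) h → P Γ b A k → P Γ (.app a b) (B.inst b) (.app h k))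
    (conv : ∀ {Γ : Ctx} {a A B : Exp} {s : Srt} (h : Typing Γ a A) (k : Typing Γ B (.sort s))
      (c : Conv A B), P Γ a A h → P Γ B (.sort s) k → P Γ a B (.conv h k c))
    {Γ : Ctx} {a A : Exp} (h : Typing Γ a A) : P Γ a A h := by
  refine Typing.rec (motive_1 := P) (motive_2 := fun _ _ => True)
    ?_ ?_ ?_ ?_ ?_ ?_ ?_ ?_ h
  · rintro Γ _ _ h ⟨⟩ -
    exact sort h
  · exact fun h k _ => var h k
  · intro Γ A B s₁ s₂ s₃ h k r ih ik
    cases r.eq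
    exact pi h k ih ik
  · exact fun h k ih ik => lam h k ih ik
  · exact fun h k ih ik => app h k ih ik
  · exact fun h k c ih ik => conv h k c ih ik
  · trivial
  · exact fun _ _ => trivial

theorem Typing.wf {Γ : Ctx} {a A : Exp} (h : Typing Γ a A) : Wf Γ := by
  induction h using Typing.ind <;> assumption

theorem Wf.tail {Γ : Ctx} {A : Exp} (h : Wf (A :: Γ)) : ∃ s, Typing Γ A (.sort s) := by
  cases h
  exact ⟨_, by assumption⟩

/-- Well-formedness of the extended context already types the domain, and every pair of sorts admits
a rule. -/
theorem Typing.pi' {Γ : Ctx} {A B : Exp} {s : Srt} (h : Typing (A :: Γ) B (.sort s)) :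
    Typing Γ (.pi A B) (.sort s) := by
  obtain ⟨t, hA⟩ := h.wf.tail
  exact .pi hA h (rule_intro _ _)

/-! ### Generation -/

theorem Typing.sort_inv {Γ : Ctx} {s : Srt} {T : Exp} (h : Typing Γ (.sort s) T) :
    s = .star ∧ Conv (.sort .box) T := by
  generalize e : Exp.sort s = a at h
  induction h using Typing.ind with
  | sort => cases e; exact ⟨rfl, .refl _⟩
  | conv _ _ c ih _ => exact ⟨(ih e).1, (ih e).2.trans c⟩
  | _ => cases e

theorem Typing.var_inv {Γ : Ctx} {n : ℕ} {T : Exp} (h : Typing Γ (.var n) T) :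
    ∃ A, Lookup Γ n A ∧ Conv A T := by
  generalize e : Exp.var n = a at h
  induction h using Typing.ind with
  | var _ k => cases e; exact ⟨_, k, .refl _⟩
  | conv _ _ c ih _ =>
    obtain ⟨A, k, d⟩ := ih e
    exact ⟨A, k, d.trans c⟩
  | _ => cases e

theorem Typing.pi_inv {Γ : Ctx} {A B T : Exp} (h : Typing Γ (.pi A B) T) :
    ∃ s, Typing (A :: Γ) B (.sort s) ∧ Conv (.sort s) T := by
  generalize e : Exp.pi A B = a at h
  induction h using Typing.ind with
  | pi _ k => cases e; exact ⟨_, k, .refl _⟩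
  | conv _ _ c ih _ =>
    obtain ⟨s, k, d⟩ := ih e
    exact ⟨s, k, d.trans c⟩
  | _ => cases e

theorem Typing.pi_cod {Γ : Ctx} {A B : Exp} {s : Srt} (h : Typing Γ (.pi A B) (.sort s)) :
    Typing (A :: Γ) B (.sort s) := by
  obtain ⟨t, k, c⟩ := h.pi_inv
  cases c.sort_inj
  exact k

theorem Typing.lam_inv {Γ : Ctx} {A b T : Exp} (h : Typing Γ (.lam A b) T) :
    ∃ B s, Typing (A :: Γ) B (.sort s) ∧ Typing (A :: Γ) b B ∧ Conv (.pi A B) T := by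
  generalize e : Exp.lam A b = a at h
  induction h using Typing.ind with
  | lam k l => cases e; exact ⟨_, _, k.pi_cod, l, .refl _⟩
  | conv _ _ c ih _ =>
    obtain ⟨B, s, k, l, d⟩ := ih e
    exact ⟨B, s, k, l, d.trans c⟩
  | _ => cases e

theorem Typing.app_inv {Γ : Ctx} {a b T : Exp} (h : Typing Γ (.app a b) T) :
    ∃ A B, Typing Γ a (.pi A B) ∧ Typing Γ b A ∧ Conv (B.inst b) T := by
  generalize e : Exp.app a b = c at h
  induction h using Typing.ind with
  | app k l => cases e; exact ⟨_, _, k, l, .refl _⟩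
  | conv _ _ c ih _ =>
    obtain ⟨A, B, k, l, d⟩ := ih e
    exact ⟨A, B, k, l, d.trans c⟩
  | _ => cases e

theorem not_typing_box {Γ : Ctx} {T : Exp} : ¬ Typing Γ (.sort .box) T := by
  intro h
  cases h.sort_inv.1

/-! ### Renaming and substitution -/

/-- `f` renames the variables of `Γ` to variables of `Δ` of the same types. -/
def Renames (Δ : Ctx) (f : ℕ → ℕ) (Γ : Ctx) : Prop :=
  ∀ n A, Lookup Γ n A → Lookup Δ (f n) (A.rename f)

theorem Renames.succ (Γ : Ctx) (B : Exp) : Renames (B :: Γ) Nat.succ Γ :=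
  fun _ _ h => .succ _ h

theorem Renames.up {Γ Δ : Ctx} {f : ℕ → ℕ} (h : Renames Δ f Γ) (A : Exp) :
    Renames (A.rename f :: Δ) (cons 0 fun n => f n + 1) (A :: Γ) := by
  intro n B hB
  cases hB with
  | zero => rw [Exp.shift_rename]; exact .zero _ _
  | succ _ hB => rw [Exp.shift_rename]; exact .succ _ (h _ _ hB)

/-- Renaming has to precede substitution: below a binder the substituted expressions are weakened.
-/
theorem Typing.rename {Γ Δ : Ctx} {a A : Exp} {f : ℕ → ℕ} (h : Typing Γ a A) (hΔ : Wf Δ)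
    (hf : Renames Δ f Γ) : Typing Δ (a.rename f) (A.rename f) := by
  induction h using Typing.ind generalizing Δ f with
  | sort => exact .sort hΔ .star_box
  | var _ k => exact .var hΔ (hf _ _ k)
  | pi _ _ ihA ihB => exact .pi' (ihB (.cons (ihA hΔ hf)) (hf.up _))
  | lam _ _ ih ihb =>
    have k := ih hΔ hf
    exact .lam k (ihb k.pi_cod.wf (hf.up _))
  | app _ _ iha ihb => rw [Exp.inst_rename]; exact .app (iha hΔ hf) (ihb hΔ hf)
  | conv _ _ c iha ihB => exact .conv (iha hΔ hf) (ihB hΔ hf) (c.rename f)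

theorem Typing.shift {Γ : Ctx} {a A B : Exp} (h : Typing Γ a A) (hB : Wf (B :: Γ)) :
    Typing (B :: Γ) a.shift A.shift :=
  h.rename hB (.succ _ _)

theorem Lookup.typing {Γ : Ctx} {n : ℕ} {A : Exp} (h : Lookup Γ n A) (hΓ : Wf Γ) :
    ∃ s, Typing Γ A (.sort s) := by
  induction h with
  | zero Γ A =>
    obtain ⟨s, hA⟩ := hΓ.tail
    exact ⟨s, hA.shift hΓ⟩
  | succ B _ ih =>
    obtain ⟨t, hB⟩ := hΓ.tail
    obtain ⟨s, hA⟩ := ih hB.wf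
    exact ⟨s, hA.shift hΓ⟩

theorem Lookup.unique {Γ : Ctx} {n : ℕ} {A B : Exp} (hA : Lookup Γ n A) (hB : Lookup Γ n B) :
    A = B := by
  induction hA generalizing B with
  | zero => cases hB; rfl
  | succ _ _ ih =>
    cases hB with
    | succ _ hB => rw [ih hB]

/-- `θ` substitutes for the variables of `Γ` expressions of the same types in `Δ`. -/
def Substs (Δ : Ctx) (θ : ℕ → Exp) (Γ : Ctx) : Prop :=
  ∀ n A, Lookup Γ n A → Typing Δ (θ n) (A.subst θ)

theorem Substs.up {Γ Δ : Ctx} {θ : ℕ → Exp} (h : Substs Δ θ Γ) {A : Exp}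
    (hA : Wf (A.subst θ :: Δ)) : Substs (A.subst θ :: Δ) (up θ) (A :: Γ) := by
  intro n B hB
  cases hB with
  | zero => rw [Exp.shift_subst_up]; exact .var hA (.zero _ _)
  | succ _ hB => rw [Exp.shift_subst_up]; exact (h _ _ hB).shift hA

theorem Renames.substs {Γ Δ : Ctx} {f : ℕ → ℕ} (h : Renames Δ f Γ) (hΔ : Wf Δ) :
    Substs Δ (fun n => .var (f n)) Γ := by
  intro n A hA
  rw [← Exp.rename_eq_subst]
  exact .var hΔ (h _ _ hA)

theorem Typing.subst {Γ Δ : Ctx} {a A : Exp} {θ : ℕ → Exp} (h : Typing Γ a A) (hΔ : Wf Δ)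
    (hθ : Substs Δ θ Γ) : Typing Δ (a.subst θ) (A.subst θ) := by
  induction h using Typing.ind generalizing Δ θ with
  | sort => exact .sort hΔ .star_box
  | var _ k => exact hθ _ _ k
  | pi _ _ ihA ihB =>
    have k : Wf (_ :: Δ) := .cons (ihA hΔ hθ)
    exact .pi' (ihB k (hθ.up k))
  | lam _ _ ih ihb =>
    have k := ih hΔ hθ
    exact .lam k (ihb k.pi_cod.wf (hθ.up k.pi_cod.wf))
  | app _ _ iha ihb => rw [Exp.inst_subst]; exact .app (iha hΔ hθ) (ihb hΔ hθ)
  | conv _ _ c iha ihB => exact .conv (iha hΔ hθ) (ihB hΔ hθ) (c.subst θ)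

theorem Substs.inst {Γ : Ctx} {a A : Exp} (h : Typing Γ a A) :
    Substs Γ (cons a Exp.var) (A :: Γ) := by
  intro n B hB
  cases hB with
  | zero => rw [Exp.shift_subst_cons, Exp.subst_var]; exact h
  | succ _ hB => rw [Exp.shift_subst_cons, Exp.subst_var]; exact .var h.wf hB

theorem Typing.inst {Γ : Ctx} {a A b B : Exp} (hb : Typing (A :: Γ) b B) (ha : Typing Γ a A) :
    Typing Γ (b.inst a) (B.inst a) :=
  hb.subst ha.wf (.inst ha)

/-- Replacing a declared type by a convertible one is the identity substitution, so context
conversion becomes an instance of the substitution lemma. -/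
theorem Substs.conv {Γ : Ctx} {A A' : Exp} (hA : Wf (A :: Γ)) (hA' : Wf (A' :: Γ))
    (h : Conv A A') : Substs (A' :: Γ) Exp.var (A :: Γ) := by
  intro n B hB
  rw [Exp.subst_var]
  cases hB with
  | zero =>
    obtain ⟨s, hA⟩ := hA.tail
    exact .conv (.var hA' (.zero _ _)) (hA.shift hA') (h.symm.rename _)
  | succ _ hB => exact .var hA' (.succ _ hB)

theorem Typing.conv_ctx {Γ : Ctx} {A A' b B : Exp} (hb : Typing (A :: Γ) b B)
    (hA' : Wf (A' :: Γ)) (h : Conv A A') : Typing (A' :: Γ) b B := by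
  have := hb.subst hA' (.conv hb.wf hA' h)
  rwa [Exp.subst_var, Exp.subst_var] at this

/-! ### Types of types, subject reduction, uniqueness of types -/

theorem Typing.type_correct {Γ : Ctx} {a A : Exp} (h : Typing Γ a A) :
    A = .sort .box ∨ ∃ s, Typing Γ A (.sort s) := by
  induction h using Typing.ind with
  | sort => exact .inl rfl
  | var hΓ k => exact .inr (k.typing hΓ)
  | pi _ hB _ ihB =>
    rcases ihB with h | ⟨s, h⟩
    · exact .inl h
    · obtain ⟨rfl, c⟩ := h.sort_inv
      have := c.sort_inj
      subst this
      exact .inr ⟨_, .sort ‹Typing _ _ _›.wf .star_box⟩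
  | lam h _ _ _ => exact .inr ⟨_, h⟩
  | app _ hb iha _ =>
    rcases iha with h | ⟨s, h⟩
    · cases h
    · exact .inr ⟨s, h.pi_cod.inst hb⟩
  | conv _ h _ _ _ => exact .inr ⟨_, h⟩

theorem Typing.pi_type {Γ : Ctx} {a A B : Exp} (h : Typing Γ a (.pi A B)) :
    ∃ s, Typing (A :: Γ) B (.sort s) := by
  rcases h.type_correct with h | ⟨s, h⟩
  · cases h
  · exact ⟨s, h.pi_cod⟩

theorem Typing.step {Γ : Ctx} {a a' A : Exp} (h : Typing Γ a A) (r : Step a a') :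
    Typing Γ a' A := by
  induction h using Typing.ind generalizing a' with
  | sort => cases r
  | var => cases r
  | pi hA hB ihA ihB =>
    cases r with
    | pi_left _ r => exact .pi' (hB.conv_ctx (.cons (ihA r)) r.conv)
    | pi_right _ r => exact .pi' (ihB r)
  | lam h hb ih ihb =>
    cases r with
    | lam_left _ r =>
      have k := ih (.pi_left _ r)
      exact .conv (.lam k (hb.conv_ctx k.pi_cod.wf r.conv)) h
        (r.conv.symm.pi (.refl _))
    | lam_right _ r => exact .lam h (ihb r)
  | app ha hb iha ihb =>
    obtain ⟨s, hB⟩ := ha.pi_type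
    cases r with
    | beta A' b a =>
      obtain ⟨B', t, hB', hb', c⟩ := ha.lam_inv
      obtain ⟨cA, cB⟩ := c.pi_inj
      obtain ⟨t', hA'⟩ := hB'.wf.tail
      exact .conv (hb'.inst (.conv hb hA' cA.symm)) (hB.inst hb) (cB.subst _)
    | app_left _ r => exact .app (iha r) hb
    -- Reducing the argument changes the type from `B.inst b` to an instance at the reduct;
    -- conversion restores it.
    | app_right _ r =>
      exact .conv (.app ha (ihb r)) (hB.inst hb)
        (Red.inst_right _ (.single r)).conv.symm
  | conv _ hB c iha _ => exact .conv (iha r) hB c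

theorem Typing.red {Γ : Ctx} {a a' A : Exp} (h : Typing Γ a A) (r : Red a a') :
    Typing Γ a' A := by
  induction r with
  | refl => exact h
  | tail _ r ih => exact ih.step r

theorem Typing.unique {Γ : Ctx} {a A B : Exp} (hA : Typing Γ a A) (hB : Typing Γ a B) :
    Conv A B := by
  induction a generalizing Γ A B with
  | sort s => exact hA.sort_inv.2.symm.trans hB.sort_inv.2
  | var n =>
    obtain ⟨C, h, c⟩ := hA.var_inv
    obtain ⟨D, k, d⟩ := hB.var_inv
    cases h.unique k
    exact c.symm.trans d
  | pi A₁ B₁ _ ih =>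
    obtain ⟨s, h, c⟩ := hA.pi_inv
    obtain ⟨t, k, d⟩ := hB.pi_inv
    cases (ih h k).sort_inj
    exact c.symm.trans d
  | lam A₁ b _ ih =>
    obtain ⟨C, s, -, h, c⟩ := hA.lam_inv
    obtain ⟨D, t, -, k, d⟩ := hB.lam_inv
    exact c.symm.trans (((Conv.refl A₁).pi (ih h k)).trans d)
  | app a b ih _ =>
    obtain ⟨A₁, B₁, h, -, c⟩ := hA.app_inv
    obtain ⟨A₂, B₂, k, -, d⟩ := hB.app_inv
    exact c.symm.trans (((ih h k).pi_inj.2.subst _).trans d)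

/-- Subject reduction gives a common reduct both sorts, and types are unique. -/
theorem Typing.sort_eq {Γ : Ctx} {A B : Exp} {s t : Srt} (hA : Typing Γ A (.sort s))
    (hB : Typing Γ B (.sort t)) (h : Conv A B) : s = t := by
  obtain ⟨C, h₁, h₂⟩ := h.join
  exact ((hA.red h₁).unique (hB.red h₂)).sort_inj

theorem Typing.not_conv_box {Γ : Ctx} {A T : Exp} (hA : Typing Γ A T) :
    ¬ Conv A (.sort .box) :=
  fun h => not_typing_box (hA.red h.red_sort)

/-! ### Kinds and constructors -/

/-- The type of an application is convertible to a typable expression, while □ has no type. The same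
reason excludes variables, so kinds are built from ∗ by products. -/
theorem Typing.app_kind {Γ : Ctx} {a b : Exp} : ¬ Typing Γ (.app a b) (.sort .box) := by
  intro h
  obtain ⟨A, B, ha, hb, c⟩ := h.app_inv
  obtain ⟨s, hB⟩ := ha.pi_type
  exact (hB.inst hb).not_conv_box c

theorem Typing.var_kind {Γ : Ctx} {n : ℕ} : ¬ Typing Γ (.var n) (.sort .box) := by
  intro h
  obtain ⟨A, hA, c⟩ := h.var_inv
  obtain ⟨s, hA⟩ := hA.typing h.wf
  exact hA.not_conv_box c

theorem Typing.lam_kind {Γ : Ctx} {A b : Exp} {s : Srt} : ¬ Typing Γ (.lam A b) (.sort s) := by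
  intro h
  obtain ⟨B, t, -, -, c⟩ := h.lam_inv
  exact not_conv_pi_sort c

/-- The context witnessing `IsKind` is unrelated to `Γ`, so uniqueness of types does not apply. The
shape decides instead: a kind is a chain of products ending in ∗, and such a chain has sort □
wherever it is typed by a sort. -/
theorem Typing.sort_of_isKind {Γ : Ctx} {A : Exp} {s : Srt} (h : Typing Γ A (.sort s))
    (hA : IsKind A) : s = .box := by
  obtain ⟨Δ, k⟩ := hA
  induction A generalizing Γ Δ with
  | sort t => exact h.sort_inv.2.sort_inj.symm
  | var n => exact absurd k Typing.var_kind
  | pi A B _ ih => exact ih h.pi_cod _ k.pi_cod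
  | lam A b => exact absurd k Typing.lam_kind
  | app a b => exact absurd k Typing.app_kind

theorem Typing.isKind_iff {Γ : Ctx} {A : Exp} {s : Srt} (h : Typing Γ A (.sort s)) :
    IsKind A ↔ s = .box :=
  ⟨h.sort_of_isKind, fun e => ⟨Γ, e ▸ h⟩⟩

theorem Wf.typing_kind {Γ : Ctx} {A : Exp} (h : Wf (A :: Γ)) (hA : IsKind A) :
    Typing Γ A (.sort .box) := by
  obtain ⟨s, k⟩ := h.tail
  cases k.sort_of_isKind hA
  exact k

theorem Typing.isConstructor_iff {Γ : Ctx} {a A : Exp} {s : Srt} (h : Typing Γ a A)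
    (hA : Typing Γ A (.sort s)) : IsConstructor Γ a ↔ s = .box := by
  constructor
  · rintro ⟨B, hB, k⟩
    exact hA.sort_eq k (h.unique hB)
  · rintro rfl
    exact ⟨A, h, hA⟩

theorem Typing.isKind_subst {Γ Δ : Ctx} {A : Exp} {s : Srt} {θ : ℕ → Exp}
    (h : Typing Γ A (.sort s)) (hΔ : Wf Δ) (hθ : Substs Δ θ Γ) :
    IsKind (A.subst θ) ↔ IsKind A := by
  rw [h.isKind_iff, (h.subst hΔ hθ).isKind_iff (s := s)]

theorem Typing.isKind_conv {Γ : Ctx} {A B : Exp} {s t : Srt} (hA : Typing Γ A (.sort s))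
    (hB : Typing Γ B (.sort t)) (h : Conv A B) : IsKind A ↔ IsKind B := by
  rw [hA.isKind_iff, hB.isKind_iff, hA.sort_eq hB h]

/-- `a` is a kind or a `Γ`-constructor. -/
def Interpretable (Γ : Ctx) (a : Exp) : Prop :=
  ∃ T, Typing Γ a T ∧ (T = .sort .box ∨ Typing Γ T (.sort .box))

theorem Typing.interpretable {Γ : Ctx} {A : Exp} {s : Srt} (h : Typing Γ A (.sort s)) :
    Interpretable Γ A := by
  cases s with
  | star => exact ⟨_, h, .inr (.sort h.wf .star_box)⟩
  | box => exact ⟨_, h, .inl rfl⟩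

theorem Interpretable.var_inv {Γ : Ctx} {n : ℕ} (h : Interpretable Γ (.var n)) :
    ∃ A, Lookup Γ n A ∧ IsKind A := by
  obtain ⟨T, h, rfl | hT⟩ := h
  · exact absurd h Typing.var_kind
  · obtain ⟨A, hA, c⟩ := h.var_inv
    obtain ⟨s, k⟩ := hA.typing h.wf
    exact ⟨A, hA, (k.isKind_conv hT c).2 ⟨_, hT⟩⟩

theorem Interpretable.pi_inv {Γ : Ctx} {A B : Exp} (h : Interpretable Γ (.pi A B)) :
    ∃ s t, Typing Γ A (.sort s) ∧ Typing (A :: Γ) B (.sort t) := by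
  obtain ⟨T, h, -⟩ := h
  obtain ⟨t, k, -⟩ := h.pi_inv
  obtain ⟨s, hA⟩ := k.wf.tail
  exact ⟨s, t, hA, k⟩

theorem Interpretable.lam_inv {Γ : Ctx} {A b : Exp} (h : Interpretable Γ (.lam A b)) :
    ∃ B, Typing (A :: Γ) b B ∧ Typing (A :: Γ) B (.sort .box) := by
  obtain ⟨T, h, rfl | hT⟩ := h
  · exact absurd h Typing.lam_kind
  · obtain ⟨B, s, hB, hb, c⟩ := h.lam_inv
    cases (Typing.pi' hB).sort_eq hT c
    exact ⟨B, hb, hB⟩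

theorem Interpretable.app_inv {Γ : Ctx} {a b : Exp} (h : Interpretable Γ (.app a b)) :
    ∃ A B s, Typing Γ a (.pi A B) ∧ Typing (A :: Γ) B (.sort .box) ∧ Typing Γ b A ∧
      Typing Γ A (.sort s) := by
  obtain ⟨T, h, rfl | hT⟩ := h
  · exact absurd h Typing.app_kind
  · obtain ⟨A, B, ha, hb, c⟩ := h.app_inv
    obtain ⟨t, hB⟩ := ha.pi_type
    obtain ⟨s, hA⟩ := hB.wf.tail
    cases (hB.inst hb).sort_eq hT c
    exact ⟨A, B, s, ha, hB, hb, hA⟩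

theorem Typing.interpretable_of_pi {Γ : Ctx} {a A B : Exp} (h : Typing Γ a (.pi A B))
    (hB : Typing (A :: Γ) B (.sort .box)) : Interpretable Γ a :=
  ⟨_, h, .inr (.pi' hB)⟩

/-! ### Strong normalization and saturated sets -/

/-- Dependent choice builds an infinite reduction from an inaccessible expression. Accessibility is
what makes induction along reduction available. -/
theorem mem_SN_iff_acc {a : Exp} : a ∈ SN ↔ Acc (fun b a => Step a b) a := by
  constructor
  · intro h
    by_contra hn
    have next (x : {a : Exp // ¬ Acc (fun b a => Step a b) a}) :
        ∃ y : {a : Exp // ¬ Acc (fun b a => Step a b) a}, Step x y := by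
      by_contra! k
      exact x.2 (.intro _ fun b hb => by_contra fun hb' => k ⟨b, hb'⟩ hb)
    choose g hg using next
    exact h ⟨fun n => (g^[n] ⟨a, hn⟩).1, rfl, fun n => by
      simpa only [Function.iterate_succ_apply'] using hg _⟩
  · rintro h ⟨f, rfl, hf⟩
    generalize e : f 0 = a at h
    induction h generalizing f with
    | intro a _ ih => exact ih (f 1) (e ▸ hf 0) (fun n => f (n + 1)) (fun n => hf (n + 1)) rfl

theorem SN_intro {a : Exp} (h : ∀ b, Step a b → b ∈ SN) : a ∈ SN :=
  mem_SN_iff_acc.2 (.intro _ fun b hb => mem_SN_iff_acc.1 (h b hb))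

theorem Step.mem_SN {a b : Exp} (h : Step a b) (ha : a ∈ SN) : b ∈ SN :=
  mem_SN_iff_acc.2 ((mem_SN_iff_acc.1 ha).inv h)

theorem Red.mem_SN {a b : Exp} (h : Red a b) (ha : a ∈ SN) : b ∈ SN := by
  induction h with
  | refl => exact ha
  | tail _ h ih => exact h.mem_SN ih

@[elab_as_elim]
theorem SN_induction {P : ∀ a : Exp, a ∈ SN → Prop}
    (h : ∀ (a : Exp) (ha : a ∈ SN), (∀ b (hb : Step a b), P b (hb.mem_SN ha)) → P a ha)
    {a : Exp} (ha : a ∈ SN) : P a ha := by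
  induction mem_SN_iff_acc.1 ha with
  | intro a _ ih => exact h a ha fun b hb => ih b hb (hb.mem_SN ha)

theorem SN_of_map (f : Exp → Exp) (hf : ∀ a b, Step a b → Step (f a) (f b)) {a : Exp}
    (h : f a ∈ SN) : a ∈ SN := by
  rintro ⟨g, rfl, hg⟩
  exact h ⟨fun n => f (g n), rfl, fun n => hf _ _ (hg n)⟩

theorem SN_of_subst {a : Exp} {θ : ℕ → Exp} (h : a.subst θ ∈ SN) : a ∈ SN :=
  SN_of_map (·.subst θ) (fun _ _ k => k.subst θ) h

theorem SN_app_left {a b : Exp} (h : Exp.app a b ∈ SN) : a ∈ SN :=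
  SN_of_map (Exp.app · b) (fun _ _ k => .app_left _ k) h

theorem SN_pi_left {A B : Exp} (h : Exp.pi A B ∈ SN) : A ∈ SN :=
  SN_of_map (Exp.pi · B) (fun _ _ k => .pi_left _ k) h

theorem SN_sort (s : Srt) : Exp.sort s ∈ SN := SN_intro fun _ h => by cases h

theorem SN_var (n : ℕ) : Exp.var n ∈ SN := SN_intro fun _ h => by cases h

theorem SN_pi {A B : Exp} (hA : A ∈ SN) (hB : B ∈ SN) : Exp.pi A B ∈ SN := by
  induction hA using SN_induction generalizing B with
  | h A hA ihA =>
    induction hB using SN_induction with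
    | h B hB ihB =>
      refine SN_intro fun c hc => ?_
      cases hc with
      | pi_left _ h => exact ihA _ h hB
      | pi_right _ h => exact ihB _ h

theorem IsBase.step {a b : Exp} (ha : IsBase a) (h : Step a b) : IsBase b := by
  induction ha generalizing b with
  | var n => cases h
  | app c k ih =>
    cases h with
    | beta => cases k
    | app_left _ h => exact .app _ (ih h)
    | app_right _ h => exact .app _ k

theorem SN_app_of_isBase {a b : Exp} (hb : IsBase a) (ha : a ∈ SN) (h : b ∈ SN) :
    Exp.app a b ∈ SN := by
  induction ha using SN_induction generalizing b with
  | h a ha iha =>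
    induction h using SN_induction with
    | h b h ihb =>
      refine SN_intro fun c hc => ?_
      cases hc with
      | beta => cases hb
      | app_left _ k => exact iha _ k (hb.step k) h
      | app_right _ k => exact ihb _ k

/-- A reduct is either the contractum or again a redex with one of `A`, `b`, `a` reduced; in the
latter case the contractum is reduced in zero or more steps and stays strongly normalizing. This
calls for nested inductions on the three parts. -/
theorem SN_beta {A b a : Exp} (hA : A ∈ SN) (ha : a ∈ SN) (h : b.inst a ∈ SN) :
    Exp.app (.lam A b) a ∈ SN := by
  have hb : b ∈ SN := SN_of_subst h
  induction hA using SN_induction generalizing b a with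
  | h A hA ihA =>
    induction hb using SN_induction generalizing a with
    | h b hb ihb =>
      induction ha using SN_induction with
      | h a ha iha =>
        refine SN_intro fun c hc => ?_
        cases hc with
        | beta => exact h
        | app_left _ k =>
          cases k with
          | lam_left _ k => exact ihA _ k ha h hb
          | lam_right _ k => exact ihb _ k ha ((k.subst _).mem_SN h)
        | app_right _ k => exact iha _ k ((Red.inst_right b (.single k)).mem_SN h)

theorem KeyRed.not_lam {A b c : Exp} : ¬ KeyRed (.lam A b) c := by
  intro h; cases h

/-- A step either contracts the key redex or leaves one in place. The contracta are then related by
several steps or none, since contraction may copy or erase what was reduced. -/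
theorem KeyRed.step {a a' b : Exp} (h : KeyRed a a') (k : Step a b) :
    b = a' ∨ ∃ b', KeyRed b b' ∧ Red a' b' := by
  induction h generalizing b with
  | beta A d c =>
    cases k with
    | beta => exact .inl rfl
    | app_left _ k =>
      cases k with
      | lam_left _ k => exact .inr ⟨_, .beta _ _ _, .refl⟩
      | lam_right _ k => exact .inr ⟨_, .beta _ _ _, .single (k.subst _)⟩
    | app_right _ k => exact .inr ⟨_, .beta _ _ _, Red.inst_right d (.single k)⟩
  | app c h ih =>
    cases k with
    | beta => exact absurd h KeyRed.not_lam
    | app_left _ k =>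
      rcases ih k with rfl | ⟨b', h₁, h₂⟩
      · exact .inl rfl
      · exact .inr ⟨_, .app _ h₁, h₂.app .refl⟩
    | app_right _ k => exact .inr ⟨_, .app _ h, .single (.app_right _ k)⟩

/-- Expansion in `arrow S T` must supply strong normalization of the application, not only of the
function. -/
theorem SN_app_of_keyRed {a a' b : Exp} (ha : a ∈ SN) (h : KeyRed a a') (hb : b ∈ SN)
    (k : Exp.app a' b ∈ SN) : Exp.app a b ∈ SN := by
  induction ha using SN_induction generalizing a' b with
  | h a ha iha =>
    induction hb using SN_induction with
    | h b hb ihb =>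
      refine SN_intro fun c hc => ?_
      cases hc with
      | beta => exact absurd h KeyRed.not_lam
      | app_left _ l =>
        rcases h.step l with rfl | ⟨b', h₁, h₂⟩
        · exact k
        · exact iha _ l h₁ hb ((h₂.app .refl).mem_SN k)
      | app_right _ l => exact ihb _ l ((Step.app_right _ l).mem_SN k)

theorem saturated_SN : Saturated SN where
  subset_SN := fun _ h => h
  base_mem := fun _ h _ => h
  expand := fun _ _ h _ _ => h

theorem Saturated.var_mem {S : Set Exp} (h : Saturated S) (n : ℕ) : Exp.var n ∈ S :=
  h.base_mem _ (SN_var n) (.var n)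

/-- Strong normalization of members is seen by applying them to a variable, which every saturated
set contains. -/
theorem Saturated.arrow {S T : Set Exp} (hS : Saturated S) (hT : Saturated T) :
    Saturated (arrow S T) where
  subset_SN := fun _ h => SN_app_left (hT.subset_SN (h _ (hS.var_mem 0)))
  base_mem := fun _ h hb _ hbS =>
    hT.base_mem _ (SN_app_of_isBase hb h (hS.subset_SN hbS)) (.app _ hb)
  expand := fun _ _ h hk ha b hbS =>
    hT.expand _ _ (SN_app_of_keyRed h hk (hS.subset_SN hbS) (hT.subset_SN (ha b hbS)))
      (.app _ hk) (ha b hbS)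

/-- An empty intersection would contain every expression, so the index set must be inhabited; for
products over a kind this is `Typing.V_nonempty`. -/
theorem saturated_forall_mem {I : Type*} {P : I → Prop} (hP : ∃ i, P i) {S : I → Set Exp}
    (h : ∀ i, P i → Saturated (S i)) : Saturated {a | ∀ i, P i → a ∈ S i} where
  subset_SN := fun _ ha => by
    obtain ⟨i, hi⟩ := hP
    exact (h i hi).subset_SN (ha i hi)
  base_mem := fun _ ha hb i hi => (h i hi).base_mem _ ha hb
  expand := fun _ _ ha hk ha' i hi => (h i hi).expand _ _ ha hk (ha' i hi)

theorem mem_SAT {z : ZFSet.{0}} : z ∈ SAT ↔ ∃ S, Saturated S ∧ ofSet S = z := by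
  simp [SAT]

theorem ofSet_mem_SAT {S : Set Exp} (h : Saturated S) : ofSet S ∈ SAT :=
  mem_SAT.2 ⟨S, h, rfl⟩

theorem saturated_elems {z : ZFSet.{0}} (h : z ∈ SAT) : Saturated (elems z) := by
  obtain ⟨S, hS, rfl⟩ := mem_SAT.1 h
  rwa [elems_ofSet]

/-! ### Set-theoretic functions -/

theorem graph_congr {D : ZFSet.{0}} {F G : ZFSet.{0} → ZFSet.{0}} (h : ∀ S ∈ D, F S = G S) :
    graph D F = graph D G := by
  ext p
  simp only [mem_graph]
  exact exists_congr fun S => and_congr_right fun hS => by rw [h S hS]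

theorem graph_mem_funs {D E : ZFSet.{0}} {F : ZFSet.{0} → ZFSet.{0}} (h : ∀ S ∈ D, F S ∈ E) :
    graph D F ∈ ZFSet.funs D E := by
  rw [ZFSet.mem_funs]
  refine ⟨fun p hp => ?_, fun S hS => ⟨F S, mem_graph.2 ⟨S, hS, rfl⟩, fun y hy => ?_⟩⟩
  · obtain ⟨S, hS, rfl⟩ := mem_graph.1 hp
    exact ZFSet.pair_mem_prod.2 ⟨hS, h S hS⟩
  · obtain ⟨T, -, hT⟩ := mem_graph.1 hy
    obtain ⟨rfl, rfl⟩ := ZFSet.pair_inj.1 hT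
    rfl

theorem applyFun_mem {D E f S : ZFSet.{0}} (hf : f ∈ ZFSet.funs D E) (hS : S ∈ D) :
    applyFun f S ∈ E := by
  obtain ⟨hsub, h⟩ := ZFSet.mem_funs.1 hf
  have k : ∃ y, ZFSet.pair S y ∈ f := (h S hS).exists
  rw [applyFun, dif_pos k]
  exact (ZFSet.pair_mem_prod.1 (hsub k.choose_spec)).2

/-! ### The ranges `V(A)` -/

theorem V_sort (s : Srt) : V (.sort s) = SAT := by rw [V]

theorem V_pi_of_isKind {A B : Exp} (h : IsKind A) : V (.pi A B) = ZFSet.funs (V A) (V B) := by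
  rw [V, if_pos h]

theorem V_pi_of_not_isKind {A B : Exp} (h : ¬ IsKind A) : V (.pi A B) = V B := by
  rw [V, if_neg h]

theorem Typing.V_nonempty {Γ : Ctx} {A : Exp} (h : Typing Γ A (.sort .box)) : ∃ S, S ∈ V A := by
  induction A generalizing Γ with
  | sort s => exact ⟨_, V_sort s ▸ ofSet_mem_SAT saturated_SN⟩
  | var n => exact absurd h Typing.var_kind
  | pi A B _ ih =>
    obtain ⟨S, hS⟩ := ih h.pi_cod
    by_cases hA : IsKind A
    · exact ⟨_, V_pi_of_isKind hA ▸ graph_mem_funs (F := fun _ => S) fun _ _ => hS⟩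
    · exact ⟨S, by rwa [V_pi_of_not_isKind hA]⟩
  | lam A b => exact absurd h Typing.lam_kind
  | app a b => exact absurd h Typing.app_kind

/-- On kinds, V sees only the product structure and which domains are kinds; substitution alters
neither. -/
theorem Typing.V_subst {Γ Δ : Ctx} {A : Exp} {θ : ℕ → Exp} (h : Typing Γ A (.sort .box))
    (hΔ : Wf Δ) (hθ : Substs Δ θ Γ) : V (A.subst θ) = V A := by
  induction A generalizing Γ Δ θ with
  | sort s => rfl
  | var n => exact absurd h Typing.var_kind
  | pi A B ihA ihB =>
    have hB := h.pi_cod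
    obtain ⟨s, hA⟩ := hB.wf.tail
    have k : Wf (A.subst θ :: Δ) := .cons (hA.subst hΔ hθ)
    have eB : V (B.subst (up θ)) = V B := ihB hB k (hθ.up k)
    have e := hA.isKind_subst hΔ hθ
    by_cases hk : IsKind A
    · rw [Exp.subst, V_pi_of_isKind (e.2 hk), V_pi_of_isKind hk, eB,
        ihA (hB.wf.typing_kind hk) hΔ hθ]
    · rw [Exp.subst, V_pi_of_not_isKind (mt e.1 hk), V_pi_of_not_isKind hk, eB]
  | lam A b => exact absurd h Typing.lam_kind
  | app a b => exact absurd h Typing.app_kind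

theorem Typing.V_shift {Γ : Ctx} {A B : Exp} (h : Typing Γ A (.sort .box)) (hB : Wf (B :: Γ)) :
    V A.shift = V A := by
  rw [Exp.shift, Exp.rename_eq_subst]
  exact h.V_subst hB ((Renames.succ Γ B).substs hB)

theorem Typing.V_step {Γ : Ctx} {A A' : Exp} (h : Typing Γ A (.sort .box)) (r : Step A A') :
    V A' = V A := by
  induction A generalizing Γ A' with
  | sort s => cases r
  | var n => cases r
  | pi A B ihA ihB =>
    have hB := h.pi_cod
    obtain ⟨s, hA⟩ := hB.wf.tail
    cases r with
    | @pi_left _ A' _ r =>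
      have e := hA.isKind_conv (hA.step r) r.conv
      by_cases hk : IsKind A
      · rw [V_pi_of_isKind (e.1 hk), V_pi_of_isKind hk, ihA (hB.wf.typing_kind hk) r]
      · rw [V_pi_of_not_isKind (mt e.2 hk), V_pi_of_not_isKind hk]
    | pi_right _ r =>
      by_cases hk : IsKind A
      · rw [V_pi_of_isKind hk, V_pi_of_isKind hk, ihB hB r]
      · rw [V_pi_of_not_isKind hk, V_pi_of_not_isKind hk, ihB hB r]
  | lam A b => exact absurd h Typing.lam_kind
  | app a b => exact absurd h Typing.app_kind

theorem Typing.V_red {Γ : Ctx} {A A' : Exp} (h : Typing Γ A (.sort .box)) (r : Red A A') :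
    V A' = V A := by
  induction r with
  | refl => rfl
  | tail k r ih => rw [(h.red k).V_step r, ih]

theorem Typing.V_conv {Γ : Ctx} {A B : Exp} {s t : Srt} (hA : Typing Γ A (.sort s))
    (hB : Typing Γ B (.sort t)) (hk : IsKind A) (h : Conv A B) : V A = V B := by
  cases hA.sort_of_isKind hk
  cases hA.sort_eq hB h
  obtain ⟨C, h₁, h₂⟩ := h.join
  rw [← hA.V_red h₁, hB.V_red h₂]

/-! ### Equations for the interpretation -/

section
variable {A B a b : Exp} {Γ : Ctx} {σ : ℕ → ZFSet.{0}}

theorem interp_pi_of_isKind (h : IsKind A) : interp (.pi A B) Γ σ =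
    ofSet (arrow (elems (interp A Γ σ))
      {a | ∀ S ∈ V A, a ∈ elems (interp B (A :: Γ) (cons S σ))}) := by
  rw [interp, if_pos h]

theorem interp_pi_of_not_isKind (h : ¬ IsKind A) : interp (.pi A B) Γ σ =
    ofSet (arrow (elems (interp A Γ σ)) (elems (interp B (A :: Γ) (cons ∅ σ)))) := by
  rw [interp, if_neg h]

theorem interp_lam_of_isKind (h : IsKind A) : interp (.lam A b) Γ σ =
    graph (V A) fun S => interp b (A :: Γ) (cons S σ) := by
  rw [interp, if_pos h]

theorem interp_lam_of_not_isKind (h : ¬ IsKind A) : interp (.lam A b) Γ σ =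
    interp b (A :: Γ) (cons ∅ σ) := by
  rw [interp, if_neg h]

theorem interp_app_of_isConstructor (h : IsConstructor Γ b) : interp (.app a b) Γ σ =
    applyFun (interp a Γ σ) (interp b Γ σ) := by
  rw [interp, if_pos h]

theorem interp_app_of_not_isConstructor (h : ¬ IsConstructor Γ b) : interp (.app a b) Γ σ =
    interp a Γ σ := by
  rw [interp, if_neg h]

end

/-! ### Interpretation and substitution -/

/-- A congruence rule that covers the changes of `A`, `B`, `Γ` and `σ` at the same time. -/
theorem interp_pi_congr {A A' B B' : Exp} {Γ Γ' : Ctx} {σ σ' : ℕ → ZFSet.{0}}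
    (hk : IsKind A' ↔ IsKind A) (hV : IsKind A → V A' = V A)
    (hA : interp A' Γ' σ' = interp A Γ σ)
    (hB : ∀ S, (IsKind A → S ∈ V A) →
      interp B' (A' :: Γ') (cons S σ') = interp B (A :: Γ) (cons S σ)) :
    interp (.pi A' B') Γ' σ' = interp (.pi A B) Γ σ := by
  by_cases h : IsKind A
  · rw [interp_pi_of_isKind h, interp_pi_of_isKind (hk.2 h), hA, hV h]
    congr 3
    ext a
    exact forall₂_congr fun S hS => by rw [hB S fun _ => hS]
  · rw [interp_pi_of_not_isKind h, interp_pi_of_not_isKind (mt hk.1 h), hA,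
      hB ∅ fun h' => absurd h' h]

theorem interp_lam_congr {A A' b b' : Exp} {Γ Γ' : Ctx} {σ σ' : ℕ → ZFSet.{0}}
    (hk : IsKind A' ↔ IsKind A) (hV : IsKind A → V A' = V A)
    (hb : ∀ S, (IsKind A → S ∈ V A) →
      interp b' (A' :: Γ') (cons S σ') = interp b (A :: Γ) (cons S σ)) :
    interp (.lam A' b') Γ' σ' = interp (.lam A b) Γ σ := by
  by_cases h : IsKind A
  · rw [interp_lam_of_isKind h, interp_lam_of_isKind (hk.2 h), hV h]
    exact graph_congr fun S hS => hb S fun _ => hS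
  · rw [interp_lam_of_not_isKind h, interp_lam_of_not_isKind (mt hk.1 h),
      hb ∅ fun h' => absurd h' h]

theorem interp_app_congr {a a' b b' : Exp} {Γ Γ' : Ctx} {σ σ' : ℕ → ZFSet.{0}}
    (hc : IsConstructor Γ' b' ↔ IsConstructor Γ b)
    (ha : interp a' Γ' σ' = interp a Γ σ)
    (hb : IsConstructor Γ b → interp b' Γ' σ' = interp b Γ σ) :
    interp (.app a' b') Γ' σ' = interp (.app a b) Γ σ := by
  by_cases h : IsConstructor Γ b
  · rw [interp_app_of_isConstructor h, interp_app_of_isConstructor (hc.2 h), ha, hb h]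
  · rw [interp_app_of_not_isConstructor h, interp_app_of_not_isConstructor (mt hc.1 h), ha]

theorem IsConstructor.interpretable {Γ : Ctx} {a : Exp} (h : IsConstructor Γ a) :
    Interpretable Γ a := by
  obtain ⟨A, h, hA⟩ := h
  exact ⟨A, h, .inr hA⟩

/-- The environments `σ` and `σ'` agree on the constructor variables of `Γ`, up to `θ`. -/
def EnvSubst (Δ : Ctx) (σ : ℕ → ZFSet.{0}) (θ : ℕ → Exp) (Γ : Ctx) (σ' : ℕ → ZFSet.{0}) : Prop :=
  ∀ n A, Lookup Γ n A → IsKind A → interp (θ n) Δ σ = σ' n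

/-- The common part of the behaviour of interpretations under renaming and under substitution:
what is needed is that the environments remain related below a binder. -/
theorem interp_subst_of {P : (ℕ → Exp) → Prop}
    (hP : ∀ θ, P θ → P (up θ))
    (hE : ∀ {Γ Δ : Ctx} {θ : ℕ → Exp} {σ σ' : ℕ → ZFSet.{0}} {A : Exp} (S : ZFSet.{0}),
      P θ → Wf (A :: Γ) → Wf (A.subst θ :: Δ) → Substs Δ θ Γ → EnvSubst Δ σ θ Γ σ' →
        EnvSubst (A.subst θ :: Δ) (cons S σ) (up θ) (A :: Γ) (cons S σ'))
    {Γ Δ : Ctx} {a : Exp} {θ : ℕ → Exp} {σ σ' : ℕ → ZFSet.{0}} (hθP : P θ)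
    (h : Interpretable Γ a) (hΔ : Wf Δ) (hθ : Substs Δ θ Γ) (hσ : EnvSubst Δ σ θ Γ σ') :
    interp (a.subst θ) Δ σ = interp a Γ σ' := by
  induction a generalizing Γ Δ θ σ σ' with
  | sort s => simp only [Exp.subst, interp]
  | var n =>
    obtain ⟨A, hA, hk⟩ := h.var_inv
    rw [interp, Exp.subst, hσ n A hA hk]
  | pi A B ihA ihB =>
    obtain ⟨s, t, hA, hB⟩ := h.pi_inv
    have k : Wf (A.subst θ :: Δ) := .cons (hA.subst hΔ hθ)
    exact interp_pi_congr (hA.isKind_subst hΔ hθ)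
      (fun hk => (hB.wf.typing_kind hk).V_subst hΔ hθ) (ihA hθP hA.interpretable hΔ hθ hσ)
      fun S _ => ihB (hP _ hθP) hB.interpretable k (hθ.up k) (hE S hθP hB.wf k hθ hσ)
  | lam A b _ ih =>
    obtain ⟨B, hb, hB⟩ := h.lam_inv
    obtain ⟨s, hA⟩ := hB.wf.tail
    have k : Wf (A.subst θ :: Δ) := .cons (hA.subst hΔ hθ)
    exact interp_lam_congr (hA.isKind_subst hΔ hθ)
      (fun hk => (hB.wf.typing_kind hk).V_subst hΔ hθ)
      fun S _ => ih (hP _ hθP) ⟨B, hb, .inr hB⟩ k (hθ.up k) (hE S hθP hB.wf k hθ hσ)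
  | app a b iha ihb =>
    obtain ⟨A, B, s, ha, hB, hb, hA⟩ := h.app_inv
    refine interp_app_congr ?_ (iha hθP (ha.interpretable_of_pi hB) hΔ hθ hσ)
      fun hc => ihb hθP hc.interpretable hΔ hθ hσ
    -- Being a constructor depends only on the sort of the type, which the substitution preserves.
    rw [hb.isConstructor_iff hA, (hb.subst hΔ hθ).isConstructor_iff (hA.subst hΔ hθ)]

/-- Renamings are treated before substitutions to avoid a circle: under a binder a renaming still
sends variables to variables, whose values are read off the environment, whereas a general
substitution needs `interp_shift` there. -/
theorem interp_rename {Γ Δ : Ctx} {a : Exp} {f : ℕ → ℕ} {σ : ℕ → ZFSet.{0}}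
    (h : Interpretable Γ a) (hΔ : Wf Δ) (hf : Renames Δ f Γ) :
    interp (a.rename f) Δ σ = interp a Γ fun n => σ (f n) := by
  rw [Exp.rename_eq_subst]
  refine interp_subst_of (P := fun θ => ∃ f : ℕ → ℕ, θ = fun n => .var (f n)) ?_ ?_ ⟨f, rfl⟩ h hΔ
    (hf.substs hΔ) fun n A _ _ => by rw [interp]
  · rintro _ ⟨f, rfl⟩
    exact ⟨_, up_renaming f⟩
  · rintro Γ Δ _ σ σ' A S ⟨f, rfl⟩ hA - hθ hσ n B hB hk
    rw [up_renaming, interp]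
    cases hB with
    | zero => rfl
    | @succ _ n B _ hB =>
      obtain ⟨s, hA'⟩ := hA.tail
      obtain ⟨t, hB'⟩ := hB.typing hA'.wf
      have e := hσ n B hB ((hB'.isKind_iff).2 (((hB'.shift hA).isKind_iff).1 hk))
      rw [interp] at e
      exact e

theorem Typing.isKind_shift {Γ : Ctx} {A B : Exp} {s : Srt} (h : Typing Γ A (.sort s))
    (hB : Wf (B :: Γ)) : IsKind A.shift ↔ IsKind A := by
  rw [h.isKind_iff, (h.shift hB).isKind_iff (s := s)]

theorem interp_shift {Γ : Ctx} {a B : Exp} {S : ZFSet.{0}} {σ : ℕ → ZFSet.{0}}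
    (h : Interpretable Γ a) (hB : Wf (B :: Γ)) :
    interp a.shift (B :: Γ) (cons S σ) = interp a Γ σ :=
  interp_rename h hB (.succ _ _)

theorem interp_subst {Γ Δ : Ctx} {a : Exp} {θ : ℕ → Exp} {σ σ' : ℕ → ZFSet.{0}}
    (h : Interpretable Γ a) (hΔ : Wf Δ) (hθ : Substs Δ θ Γ) (hσ : EnvSubst Δ σ θ Γ σ') :
    interp (a.subst θ) Δ σ = interp a Γ σ' := by
  refine interp_subst_of (P := fun _ => True) (fun _ _ => trivial) ?_ trivial h hΔ hθ hσ
  intro Γ Δ θ σ σ' A S _ hA hA' hθ hσ n B hB hk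
  cases hB with
  | zero => simp only [up, cons_zero, interp]
  | @succ _ n B _ hB =>
    obtain ⟨s, k⟩ := hA.tail
    obtain ⟨t, hB'⟩ := hB.typing k.wf
    have hk' := (hB'.isKind_shift hA).1 hk
    cases hB'.sort_of_isKind hk'
    obtain ⟨s, k'⟩ := hA'.tail
    rw [cons_succ, ← hσ n B hB hk']
    exact interp_shift ⟨_, hθ n B hB, .inr (hB'.subst k'.wf hθ)⟩ hA'

/-- When `A` is not a kind, `S` is arbitrary: the interpretation never consults variables of such
types. This covers the filler `∅` as well as the value of a constructor. -/
theorem interp_inst {Γ : Ctx} {A a b : Exp} {S : ZFSet.{0}} {σ : ℕ → ZFSet.{0}}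
    (hb : Interpretable (A :: Γ) b) (ha : Typing Γ a A) (hS : IsKind A → interp a Γ σ = S) :
    interp (b.inst a) Γ σ = interp b (A :: Γ) (cons S σ) := by
  obtain ⟨T, hT, -⟩ := id hb
  obtain ⟨s, hA⟩ := hT.wf.tail
  refine interp_subst hb ha.wf (.inst ha) fun n B hB hk => ?_
  cases hB with
  | zero => exact hS ((hA.isKind_shift hT.wf).1 hk)
  | succ _ hB => simp only [cons_succ, interp]

theorem interp_conv_ctx {Γ : Ctx} {A A' b : Exp} {σ : ℕ → ZFSet.{0}}
    (hb : Interpretable (A :: Γ) b) (hA' : Wf (A' :: Γ)) (h : Conv A A') :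
    interp b (A' :: Γ) σ = interp b (A :: Γ) σ := by
  obtain ⟨T, hT, -⟩ := id hb
  have := interp_subst (σ := σ) (σ' := σ) hb hA' (.conv hT.wf hA' h)
    fun n B _ _ => by rw [interp]
  rwa [Exp.subst_var] at this

/-! ### Interpretations belong to the ranges -/

theorem ConstructorEnv.cons {Γ : Ctx} {A : Exp} {S : ZFSet.{0}} {σ : ℕ → ZFSet.{0}}
    (h : ConstructorEnv σ Γ) (hA : Wf (A :: Γ)) (hS : IsKind A → S ∈ V A) :
    ConstructorEnv (cons S σ) (A :: Γ) where
  wf := hA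
  mem := by
    intro n B hB hk
    cases hB with
    | zero =>
      obtain ⟨s, k⟩ := hA.tail
      have hk' := (k.isKind_shift hA).1 hk
      rw [(hA.typing_kind hk').V_shift hA]
      exact hS hk'
    | succ _ hB =>
      obtain ⟨t, hB'⟩ := hB.typing h.wf
      have hk' := (hB'.isKind_shift hA).1 hk
      cases hB'.sort_of_isKind hk'
      rw [hB'.V_shift hA]
      exact h.mem _ _ hB hk'

theorem V_of_conv_sort {Γ : Ctx} {T : Exp} {s : Srt}
    (hT : T = .sort .box ∨ Typing Γ T (.sort .box)) (h : Conv (.sort s) T) : V T = SAT := by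
  rcases hT with rfl | hT
  · exact V_sort _
  · rw [← hT.V_red h.symm.red_sort, V_sort]

/-- Induction on the expression; generation determines `T` up to conversion, under which V of a kind
is invariant. -/
theorem interp_mem {Γ : Ctx} {a T : Exp} {σ : ℕ → ZFSet.{0}} (h : Typing Γ a T)
    (hT : T = .sort .box ∨ Typing Γ T (.sort .box)) (hσ : ConstructorEnv σ Γ) :
    interp a Γ σ ∈ V T := by
  -- Saturation of types is a consequence of the lemma being proved, so here it takes the induction
  -- hypothesis as an argument.
  have sat {Γ : Ctx} {A : Exp} {s : Srt} {σ : ℕ → ZFSet.{0}} (hA : Typing Γ A (.sort s))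
      (ih : (Exp.sort s = .sort .box ∨ Typing Γ (.sort s) (.sort .box)) →
        interp A Γ σ ∈ V (.sort s)) : Saturated (elems (interp A Γ σ)) := by
    refine saturated_elems (V_sort s ▸ ih ?_)
    cases s with
    | star => exact .inr (.sort hA.wf .star_box)
    | box => exact .inl rfl
  induction a generalizing Γ T σ with
  | sort s =>
    rw [V_of_conv_sort hT h.sort_inv.2, interp]
    exact ofSet_mem_SAT saturated_SN
  | var n =>
    rcases hT with rfl | hT
    · exact absurd h Typing.var_kind
    · obtain ⟨A, hA, c⟩ := h.var_inv
      obtain ⟨s, hA'⟩ := hA.typing h.wf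
      have hk : IsKind A := (hA'.isKind_conv hT c).2 ⟨_, hT⟩
      rw [interp, ← hA'.V_conv hT hk c]
      exact hσ.mem n A hA hk
  | pi A B ihA ihB =>
    obtain ⟨t, hB, c⟩ := h.pi_inv
    obtain ⟨s, hA⟩ := hB.wf.tail
    have satA := sat hA fun hs => ihA hA hs hσ
    have satB (S : ZFSet.{0}) (hS : IsKind A → S ∈ V A) :
        Saturated (elems (interp B (A :: Γ) (cons S σ))) :=
      sat hB fun hs => ihB hB hs (hσ.cons hB.wf hS)
    rw [V_of_conv_sort hT c]
    by_cases hk : IsKind A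
    · rw [interp_pi_of_isKind hk]
      exact ofSet_mem_SAT (satA.arrow (saturated_forall_mem
        (hB.wf.typing_kind hk).V_nonempty fun S hS => satB S fun _ => hS))
    · rw [interp_pi_of_not_isKind hk]
      exact ofSet_mem_SAT (satA.arrow (satB ∅ fun hk' => absurd hk' hk))
  | lam A b _ ih =>
    rcases hT with rfl | hT
    · exact absurd h Typing.lam_kind
    · obtain ⟨B, s, hB, hb, c⟩ := h.lam_inv
      have hp := Typing.pi' hB
      cases hp.sort_eq hT c
      rw [← hp.V_conv hT ⟨_, hp⟩ c]
      by_cases hk : IsKind A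
      · rw [V_pi_of_isKind hk, interp_lam_of_isKind hk]
        exact graph_mem_funs fun S hS => ih hb (.inr hB) (hσ.cons hB.wf fun _ => hS)
      · rw [V_pi_of_not_isKind hk, interp_lam_of_not_isKind hk]
        exact ih hb (.inr hB) (hσ.cons hB.wf fun hk' => absurd hk' hk)
  | app a b iha ihb =>
    rcases hT with rfl | hT
    · exact absurd h Typing.app_kind
    · obtain ⟨A, B, ha, hb, c⟩ := h.app_inv
      obtain ⟨t, hB⟩ := ha.pi_type
      obtain ⟨s, hA⟩ := hB.wf.tail
      have hBb := hB.inst hb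
      cases hBb.sort_eq hT c
      -- Although `B` may depend on the argument, its range does not: V of the instance is V of `B`.
      rw [← hBb.V_conv hT ⟨_, hBb⟩ c, Exp.inst, hB.V_subst hb.wf (.inst hb)]
      have ma := iha ha (.inr (.pi' hB)) hσ
      have e := hb.isConstructor_iff hA
      rw [← hA.isKind_iff] at e
      by_cases hk : IsKind A
      · rw [V_pi_of_isKind hk] at ma
        rw [interp_app_of_isConstructor (e.2 hk)]
        exact applyFun_mem ma (ihb hb (.inr (hB.wf.typing_kind hk)) hσ)
      · rw [V_pi_of_not_isKind hk] at ma
        rwa [interp_app_of_not_isConstructor (mt e.1 hk)]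

theorem saturated_interp {Γ : Ctx} {A : Exp} {s : Srt} {σ : ℕ → ZFSet.{0}}
    (h : Typing Γ A (.sort s)) (hσ : ConstructorEnv σ Γ) :
    Saturated (elems (interp A Γ σ)) := by
  refine saturated_elems (V_sort s ▸ interp_mem h ?_ hσ)
  cases s with
  | star => exact .inr (.sort h.wf .star_box)
  | box => exact .inl rfl

/-! ### Interpretation and conversion -/

/-- The environment must be a constructor environment because of β: a graph can be evaluated at the
argument's interpretation only if that lies in its domain `V A`, which is `interp_mem`. -/
theorem interp_step {Γ : Ctx} {a a' : Exp} {σ : ℕ → ZFSet.{0}} (r : Step a a')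
    (h : Interpretable Γ a) (hσ : ConstructorEnv σ Γ) : interp a' Γ σ = interp a Γ σ := by
  induction r generalizing Γ σ with
  | beta A b c =>
    obtain ⟨A₁, B₁, s, hl, hB₁, hc, hA₁⟩ := h.app_inv
    obtain ⟨B, hb, hB⟩ := (hl.interpretable_of_pi hB₁).lam_inv
    obtain ⟨t, hA⟩ := hB.wf.tail
    obtain ⟨B', s', hB', -, cl⟩ := hl.lam_inv
    -- The application types the argument by `A₁`, convertible to the annotation `A`. Retyping it by
    -- `A` lets the constructor test on `c` match the kind test on `A`.
    have hc' : Typing Γ c A := .conv hc hA cl.pi_inj.1.symm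
    have e := hc'.isConstructor_iff hA
    rw [← hA.isKind_iff] at e
    by_cases hk : IsKind A
    · have hA' := hB.wf.typing_kind hk
      rw [interp_app_of_isConstructor (e.2 hk), interp_lam_of_isKind hk,
        applyFun_graph (interp_mem hc' (.inr hA') hσ)]
      exact interp_inst ⟨B, hb, .inr hB⟩ hc' fun _ => rfl
    · rw [interp_app_of_not_isConstructor (mt e.1 hk), interp_lam_of_not_isKind hk]
      exact interp_inst ⟨B, hb, .inr hB⟩ hc' fun hk' => absurd hk' hk
  | pi_left B r ih =>
    obtain ⟨s, t, hA, hB⟩ := h.pi_inv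
    have hA' := hA.step r
    exact interp_pi_congr (hA'.isKind_conv hA r.conv.symm)
      (fun hk => (hB.wf.typing_kind hk).V_step r) (ih hA.interpretable hσ)
      -- The codomain is unchanged but is now read in a context with the reduced domain.
      fun S _ => interp_conv_ctx hB.interpretable (.cons hA') r.conv
  | pi_right A r ih =>
    obtain ⟨s, t, hA, hB⟩ := h.pi_inv
    exact interp_pi_congr .rfl (fun _ => rfl) rfl
      fun S hS => ih hB.interpretable (hσ.cons hB.wf hS)
  | lam_left b r ih =>
    obtain ⟨B, hb, hB⟩ := h.lam_inv
    obtain ⟨s, hA⟩ := hB.wf.tail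
    have hA' := hA.step r
    exact interp_lam_congr (hA'.isKind_conv hA r.conv.symm)
      (fun hk => (hB.wf.typing_kind hk).V_step r)
      fun S _ => interp_conv_ctx ⟨B, hb, .inr hB⟩ (.cons hA') r.conv
  | lam_right A r ih =>
    obtain ⟨B, hb, hB⟩ := h.lam_inv
    exact interp_lam_congr .rfl (fun _ => rfl)
      fun S hS => ih ⟨B, hb, .inr hB⟩ (hσ.cons hB.wf hS)
  | app_left b r ih =>
    obtain ⟨A, B, s, ha, hB, -⟩ := h.app_inv
    exact interp_app_congr .rfl (ih (ha.interpretable_of_pi hB) hσ) fun _ => rfl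
  | app_right a r ih =>
    obtain ⟨A, B, s, -, -, hb, hA⟩ := h.app_inv
    refine interp_app_congr ?_ rfl fun hc => ih hc.interpretable hσ
    rw [hb.isConstructor_iff hA, (hb.step r).isConstructor_iff hA]

theorem interp_red {Γ : Ctx} {A A' : Exp} {s : Srt} {σ : ℕ → ZFSet.{0}} (r : Red A A')
    (h : Typing Γ A (.sort s)) (hσ : ConstructorEnv σ Γ) : interp A' Γ σ = interp A Γ σ := by
  induction r with
  | refl => rfl
  | tail k r ih => rw [interp_step r (h.red k).interpretable hσ, ih]

theorem interp_conv {Γ : Ctx} {A B : Exp} {s t : Srt} {σ : ℕ → ZFSet.{0}} (c : Conv A B)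
    (hA : Typing Γ A (.sort s)) (hB : Typing Γ B (.sort t)) (hσ : ConstructorEnv σ Γ) :
    interp A Γ σ = interp B Γ σ := by
  obtain ⟨C, h₁, h₂⟩ := c.join
  rw [← interp_red h₁ hA hσ, interp_red h₂ hB hσ]

/-! ### Soundness -/

theorem TermEnv.cons {Γ : Ctx} {A a : Exp} {S : ZFSet.{0}} {σ : ℕ → ZFSet.{0}} {ρ : ℕ → Exp}
    (h : TermEnv σ ρ Γ) (hA : Wf (A :: Γ)) (hS : IsKind A → S ∈ V A)
    (ha : a ∈ elems (interp A Γ σ)) : TermEnv (cons S σ) (cons a ρ) (A :: Γ) where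
  env := h.env.cons hA hS
  mem := by
    intro n B hB
    cases hB with
    | zero =>
      obtain ⟨s, k⟩ := hA.tail
      rwa [interp_shift k.interpretable hA]
    | succ _ hB =>
      obtain ⟨t, k⟩ := hB.typing h.env.wf
      rw [interp_shift k.interpretable hA]
      exact h.mem _ _ hB

open scoped Classical in
-- Puts the two clauses for products in one form, in which a domain that is not a kind allows only
-- the filler `∅`.
theorem mem_elems_interp_pi {Γ : Ctx} {A B a : Exp} {σ : ℕ → ZFSet.{0}} :
    a ∈ elems (interp (.pi A B) Γ σ) ↔ ∀ b ∈ elems (interp A Γ σ), ∀ S,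
      (if IsKind A then S ∈ V A else S = ∅) →
        Exp.app a b ∈ elems (interp B (A :: Γ) (cons S σ)) := by
  by_cases hk : IsKind A
  · simp [interp_pi_of_isKind hk, elems_ofSet, arrow, hk]
  · simp [interp_pi_of_not_isKind hk, elems_ofSet, arrow, hk]

theorem Typing.sound {Γ : Ctx} {a A : Exp} {σ : ℕ → ZFSet.{0}} {ρ : ℕ → Exp}
    (h : Typing Γ a A) (hρ : TermEnv σ ρ Γ) : a.subst ρ ∈ elems (interp A Γ σ) := by
  induction h using Typing.ind generalizing σ ρ with
  | sort =>
    rw [interp, elems_ofSet]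
    exact SN_sort _
  | var _ k => exact hρ.mem _ _ k
  | @pi Γ A B s t hA hB ihA ihB =>
    rw [interp, elems_ofSet]
    have snA := ihA hρ
    rw [interp, elems_ofSet] at snA
    -- Any admissible value of the bound variable will do, since only strong normalization of the
    -- codomain is wanted.
    obtain ⟨S, hS⟩ : ∃ S, IsKind A → S ∈ V A := by
      by_cases hk : IsKind A
      · obtain ⟨S, hS⟩ := (hB.wf.typing_kind hk).V_nonempty
        exact ⟨S, fun _ => hS⟩
      · exact ⟨∅, fun hk' => absurd hk' hk⟩
    -- The bound variable is sent to the variable 0, which lies in every saturated set. A clash with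
    -- free variables of `ρ` is harmless: strong normalization of an instance implies that of
    -- `B.subst (up ρ)`.
    have snB := ihB (hρ.cons hB.wf hS ((saturated_interp hA hρ.env).var_mem 0))
    rw [interp, elems_ofSet, ← Exp.subst_up_inst] at snB
    exact SN_pi snA (SN_of_subst snB)
  | @lam Γ A B b s h hb ih ihb =>
    have hB := h.pi_cod
    obtain ⟨t, hA⟩ := hB.wf.tail
    have snA := ih hρ
    rw [interp, elems_ofSet] at snA
    rw [mem_elems_interp_pi]
    intro c hc S hS
    have hS' : IsKind A → S ∈ V A := fun hk => by rwa [if_pos hk] at hS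
    have hρ' := hρ.cons hB.wf hS' hc
    have m := ihb hρ'
    have satB := saturated_interp hB hρ'.env
    rw [← Exp.subst_up_inst] at m
    -- The applied abstraction has the instantiated body as its contractum. Its strong normalization
    -- also needs that of the annotation, supplied by the hypothesis on the product type.
    exact satB.expand _ _ (SN_beta (SN_pi_left snA)
      ((saturated_interp hA hρ.env).subset_SN hc) (satB.subset_SN m)) (.beta _ _ _) m
  | @app Γ A B a b ha hb iha ihb =>
    obtain ⟨t, hB⟩ := ha.pi_type
    have m := mem_elems_interp_pi.1 (iha hρ) _ (ihb hρ)
    by_cases hk : IsKind A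
    · have := m (interp b Γ σ)
        (by rw [if_pos hk]; exact interp_mem hb (.inr (hB.wf.typing_kind hk)) hρ.env)
      rwa [← interp_inst hB.interpretable hb fun _ => rfl] at this
    · have := m ∅ (by rw [if_neg hk])
      rwa [← interp_inst hB.interpretable hb fun hk' => absurd hk' hk] at this
  | conv ha hB c iha _ =>
    rcases ha.type_correct with rfl | ⟨s, hA⟩
    -- The old type cannot be □, as nothing typable is convertible to it.
    · exact absurd c.symm hB.not_conv_box
    · rw [← interp_conv c hA hB hρ.env]
      exact iha hρ

end CC

theorem mainTheorem3 (Γ : CC.Ctx) (a A : CC.Exp) (σ : ℕ → ZFSet.{0}) (ρ : ℕ → CC.Exp)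
    (ha : CC.Typing Γ a A) (hρ : CC.TermEnv σ ρ Γ) :
    a.subst ρ ∈ CC.elems (CC.interp A Γ σ) :=
  ha.sound hρ
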